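/- All graphs are finite, nonempty, simple and undirected. Write $v(G)$ for the number of nodes of $G$ and $c(F)$ for the number of connected components of $F$. **Convergence.** A pair $(G,d)$ is *admissible* if $d\ge 1$ and all degrees of $G$ are at most $d$. Put $$t(F,G,d)=\frac{\hom(F,G)}{v(G)^{c(F)}\,d^{\,v(F)-c(F)}} .$$ A sequence $(G_n,d_n)$ of admissible pairs is *convergent* if $t(F,G_n,d_n)$ converges for every graph $F$. **Graphonings.** A *graphoning* is a tuple $\mathbf G=(X,\mathcal B,\lambda,\mu,W)$ where $(X,\mathcal B,\lambda)$ is a probability space, $\mu:\mathcal B\to[0,\infty]$ is a measure and $W:X^2\to[0,1]$ is symmetric and $\mathcal B\otimes\mathcal B$-measurable, such that, with $\deg_A(x)=\int_A W(x,y)\,d\mu(y)$: $\deg_X(x)\le 1$ for all $x\in X$; $\deg_A$ is measurable for all $A\in\mathcal B$; and $\int_A\deg_B\,d\lambda=\int_B\deg_A\,d\lambda$ for all $A,B\in\mathcal B$. Let $\deg(x)$ be the measure $A\mapsto\deg_A(x)$. For a connected graph $F$, label the nodes by $0,\dots,m$, $m=v(F)-1$, so that each node $i\ge1$ has a neighbor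 $j(i)<i$; let $T$ be the spanning tree with edges $(i,j(i))$, and put $$t(F,\mathbf G)=\int_X\int_X\cdots\int_X\prod_{kl\in E(F)\setminus E(T)}W(x_k,x_l)\;d\deg(x_{j(m)})(x_m)\cdots d\deg(x_{j(1)})(x_1)\,d\lambda(x_0),$$ which does not depend on the choices made. **Euclidean limits.** A *gauge function* $h$ is nonnegative, nondecreasing and right-continuous on some $[0,\varepsilon)$, $\varepsilon>0$; the associated Hausdorff measure is $\mu_h(B)=\lim_{\delta\to0}\inf\{\sum_i h(\operatorname{diam} I_i): B\subseteq\bigcup_i I_i,\ \operatorname{diam} I_i<\delta\}$ (countable covers by nonempty sets). A graphoning $\mathbf G$ is a *Euclidean limit* of a convergent sequence $(G_n,d_n)$, with gauge function $h$, if $X=[0,1]$ with the Euclidean metric and its Borel sets, $\lambda$ is one-dimensional Hausdorff (i.e. Lebesgue) measure, $\mu=\mu_h$, $t(F,G_n,d_n)\to t(F,\mathbf G)$ for all connected graphs $F$, and $h(1/v(G_n))\sim 1/d_n$ as $n\to\infty$. **The two examples.** Let $h_{\rm cube}(x)=1/\log_2(1/x)$ (with $h_{\rm cube}(0)=0$)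 and $h_{\rm proj}(x)=\sqrt{2x}$, and let $$S_{\rm cube}=\Big\{\sum_{j\ge1}a_j2^{-j}: a_j\in\{0,1\},\ a_1=a_2,\ a_3=a_4,\ a_5=\dots=a_8,\ a_9=\dots=a_{16},\dots\Big\},$$ $$S_{\rm proj}=\Big\{\sum_{j\ge1}a_j2^{-j}: a_j\in\{0,1\},\ a_1=a_2=a_3,\ a_4=a_5,\ a_6=a_7,\ a_8=a_9,\dots\Big\}.$$ Let $\mathbf G_{\rm cube}$ and $\mathbf G_{\rm proj}$ be the tuples $([0,1],\mathcal B,\lambda,\mu_h,W)$, where $\lambda$ is Lebesgue measure on the Borel sets $\mathcal B$, $h=h_{\rm cube}$, resp. $h=h_{\rm proj}$, and $W(x,y)=1$ if $|x-y|\in S$, $W(x,y)=0$ otherwise, with $S=S_{\rm cube}$, resp. $S=S_{\rm proj}$. **Proposition.** (a) $\mu_{h_{\rm cube}}(S_{\rm cube})=1$, the tuple $\mathbf G_{\rm cube}$ is a graphoning, the sequence $(Q_d,d)_{d\ge1}$ of hypercube graphs $Q_d$ on $\{0,1\}^d$ is convergent, and $\mathbf G_{\rm cube}$ is a Euclidean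 limit of it with gauge function $h_{\rm cube}$. (b) $\mu_{h_{\rm proj}}(S_{\rm proj})=1$, and if $G_n$ is the point-line incidence graph of a finite projective plane of order $q_n$, with $q_n\to\infty$, then $\mathbf G_{\rm proj}$ is a graphoning, the sequence $(G_n,q_n+1)$ is convergent, and $\mathbf G_{\rm proj}$ is a Euclidean limit of it with gauge function $h_{\rm proj}$. -/

import Mathlib

open MeasureTheory Filter Topology
open scoped ENNReal

namespace GraphLimits

noncomputable section

/-! ### Homomorphism densities of finite graphs -/

/-- `(G, d)` is an admissible pair: `G` is a finite (nonempty, simple) graph, `d ≥ 1`, and all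
degrees of `G` are at most `d`. -/
structure IsAdmissible {V : Type*} (G : SimpleGraph V) (d : ℝ) : Prop where
  finite : Finite V
  nonempty : Nonempty V
  one_le : 1 ≤ d
  degree_le : ∀ v, ((G.neighborSet v).ncard : ℝ) ≤ d

/-- The homomorphism density `t(F, G, d) = hom(F, G) / (v(G) ^ c(F) * d ^ (v(F) - c(F)))`, where
`c(F)` is the number of connected components of `F` (note that `c(F) ≤ v(F)`). For connected `F`
this is `hom(F, G) / (v(G) * d ^ (v(F) - 1))`. -/
def homDensity {U V : Type*} (F : SimpleGraph U) (G : SimpleGraph V) (d : ℝ) : ℝ :=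
  (Nat.card (F →g G) : ℝ) /
    ((Nat.card V : ℝ) ^ Nat.card F.ConnectedComponent *
      d ^ (Nat.card U - Nat.card F.ConnectedComponent))

/-- An admissible sequence `(G n, d n)` is convergent if `t(F, G n, d n)` converges for every
finite graph `F`. -/
structure IsConvergentSeq {V : ℕ → Type*} (G : ∀ n, SimpleGraph (V n)) (d : ℕ → ℝ) : Prop where
  admissible : ∀ n, IsAdmissible (G n) (d n)
  convergent : ∀ (U : Type) [Finite U] (F : SimpleGraph U),
    ∃ l : ℝ, Tendsto (fun n => homDensity F (G n) (d n)) atTop (𝓝 l)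

/-! ### Graphonings and pseudo-graphonings -/

/-- The data `(X, 𝓑, λ, μ, W)` of a graphoning. -/
structure GraphoningData (X : Type*) [MeasurableSpace X] where
  lam : Measure X
  mu : Measure X
  W : X → X → ℝ

/-- The data `(X, 𝓑, λ, W, deg)` of a pseudo-graphoning. -/
structure PseudoGraphoningData (X : Type*) [MeasurableSpace X] where
  lam : Measure X
  W : X → X → ℝ
  deg : X → Measure X

variable {X : Type*} [MeasurableSpace X]

/-- `deg_A(x) = ∫_A W(x, y) dμ(y)`. -/
def GraphoningData.degree (D : GraphoningData X) (A : Set X) (x : X) : ℝ≥0∞ :=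
  ∫⁻ y in A, ENNReal.ofReal (D.W x y) ∂D.mu

/-- The axioms of a graphoning. -/
structure GraphoningData.IsGraphoning (D : GraphoningData X) : Prop where
  prob : IsProbabilityMeasure D.lam
  W_measurable : Measurable (fun p : X × X => D.W p.1 p.2)
  W_mem : ∀ x y, D.W x y ∈ Set.Icc (0 : ℝ) 1
  W_symm : ∀ x y, D.W x y = D.W y x
  degree_bound : ∀ x, D.degree Set.univ x ≤ 1
  degree_measurable : ∀ A, MeasurableSet A → Measurable (D.degree A)
  measure_preserving : ∀ A B, MeasurableSet A → MeasurableSet B →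
    ∫⁻ x in A, D.degree B x ∂D.lam = ∫⁻ x in B, D.degree A x ∂D.lam

/-- The axioms of a pseudo-graphoning: `deg` is a sub-Markov kernel, reversible with respect to the
probability measure `λ`, and compatible with the symmetric measurable function `W`. -/
structure PseudoGraphoningData.IsPseudoGraphoning (P : PseudoGraphoningData X) : Prop where
  prob : IsProbabilityMeasure P.lam
  W_measurable : Measurable (fun p : X × X => P.W p.1 p.2)
  W_mem : ∀ x y, P.W x y ∈ Set.Icc (0 : ℝ) 1
  W_symm : ∀ x y, P.W x y = P.W y x
  deg_le_one : ∀ x, P.deg x Set.univ ≤ 1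
  deg_measurable : ∀ A, MeasurableSet A → Measurable (fun x => P.deg x A)
  reversible : ∀ A B, MeasurableSet A → MeasurableSet B →
    ∫⁻ x in A, P.deg x B ∂P.lam = ∫⁻ x in B, P.deg x A ∂P.lam
  compatible : ∀ x₁ x₂ A, MeasurableSet A →
    ∫⁻ y in A, ENNReal.ofReal (P.W x₂ y) ∂(P.deg x₁) =
      ∫⁻ y in A, ENNReal.ofReal (P.W x₁ y) ∂(P.deg x₂)

/-- A graphoning viewed as a pseudo-graphoning: `deg(x)` is the measure `A ↦ deg_A(x)`. -/
def GraphoningData.toPseudo (D : GraphoningData X) : PseudoGraphoningData X where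
  lam := D.lam
  W := D.W
  deg x := D.mu.withDensity (fun y => ENNReal.ofReal (D.W x y))

theorem GraphoningData.toPseudo_deg (D : GraphoningData X) (x : X) {A : Set X}
    (hA : MeasurableSet A) : D.toPseudo.deg x A = D.degree A x :=
  withDensity_apply _ hA

theorem GraphoningData.IsGraphoning.isPseudoGraphoning {D : GraphoningData X}
    (h : D.IsGraphoning) : D.toPseudo.IsPseudoGraphoning where
  prob := h.prob
  W_measurable := h.W_measurable
  W_mem := h.W_mem
  W_symm := h.W_symm
  deg_le_one x := by
    rw [D.toPseudo_deg x MeasurableSet.univ]; exact h.degree_bound x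
  deg_measurable A hA := by
    simp only [D.toPseudo_deg _ hA]; exact h.degree_measurable A hA
  reversible A B hA hB := by
    simp only [D.toPseudo_deg _ hA, D.toPseudo_deg _ hB]
    exact h.measure_preserving A B hA hB
  compatible x₁ x₂ A hA := by
    have hm : ∀ x, Measurable (fun y => ENNReal.ofReal (D.W x y)) := fun x =>
      (h.W_measurable.comp measurable_prodMk_left).ennreal_ofReal
    simp only [GraphoningData.toPseudo]
    rw [setLIntegral_withDensity_eq_setLIntegral_mul _ (hm x₁) (hm x₂) hA,
      setLIntegral_withDensity_eq_setLIntegral_mul _ (hm x₂) (hm x₁) hA, mul_comm]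

/-! ### Homomorphism densities of pseudo-graphonings -/

/-- An admissible labeling of a graph `F` by `0, 1, …, v(F) - 1`, together with a choice, for each
node `v` with positive label, of a neighbor `parent v` with smaller label. (Such a choice exists if
and only if for every `i ≥ 1` the nodes with label `< i` span a connected subgraph.) The edges
`(v, parent v)` form a spanning tree of `F`. -/
structure AdmissibleLabeling {U : Type*} [Fintype U] (F : SimpleGraph U) where
  label : U ≃ Fin (Fintype.card U)
  parent : U → U
  parent_adj : ∀ v, 0 < (label v : ℕ) → F.Adj (parent v) v
  parent_lt : ∀ v, 0 < (label v : ℕ) → label (parent v) < label v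

theorem AdmissibleLabeling.nonempty {U : Type*} [Fintype U] {F : SimpleGraph U}
    (hF : F.Connected) : Nonempty (AdmissibleLabeling F) := by
  classical
  obtain ⟨o⟩ := hF.nonempty
  let e := Fintype.equivFin U
  let f : Fin (Fintype.card U) → ℕ := fun i => F.dist o (e.symm i)
  let σ := Tuple.sort f
  have hσ : Monotone (f ∘ σ) := Tuple.monotone_sort f
  let lab : U ≃ Fin (Fintype.card U) := e.trans σ.symm
  have hlab : ∀ u v, lab u ≤ lab v → F.dist o u ≤ F.dist o v := by
    intro u v h
    simpa [f, lab] using hσ h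
  have hpar : ∀ v, v ≠ o → ∃ w, F.Adj w v ∧ F.dist o w < F.dist o v := by
    intro v hv
    obtain ⟨p, hp⟩ := hF.exists_walk_length_eq_dist v o
    cases p with
    | nil => exact absurd rfl hv
    | @cons _ w _ hvw q =>
      refine ⟨w, hvw.symm, ?_⟩
      have h1 := SimpleGraph.dist_le q
      rw [SimpleGraph.Walk.length_cons] at hp
      rw [SimpleGraph.dist_comm, SimpleGraph.dist_comm (u := o) (v := v)]
      omega
  have hroot : ∀ v, 0 < (lab v : ℕ) → v ≠ o := by
    rintro v hv rfl
    let z : Fin (Fintype.card U) := ⟨0, Fintype.card_pos_iff.mpr ⟨v⟩⟩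
    have h0 : F.dist v (lab.symm z) ≤ F.dist v v := by
      refine hlab _ _ ?_
      rw [Equiv.apply_symm_apply]
      exact Fin.mk_le_of_le_val (Nat.zero_le _)
    have h1 : F.dist v (lab.symm z) = 0 := by simpa using h0
    have h2 := (hF.dist_eq_zero_iff).mp h1
    have h3 : lab v = z := by
      have := congrArg lab h2
      simpa using this
    rw [h3] at hv
    exact absurd hv (lt_irrefl 0)
  choose! par hadj hlt using hpar
  refine ⟨⟨lab, par, fun v hv => hadj v (hroot v hv), fun v hv => ?_⟩⟩
  by_contra hcon
  exact absurd (hlab _ _ (not_lt.mp hcon)) (not_le.mpr (hlt v (hroot v hv)))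

/-- The nodes with labels `1, 2, …, v(F) - 1`, in this order. -/
def AdmissibleLabeling.nonrootNodes {U : Type*} [Fintype U] {F : SimpleGraph U}
    (L : AdmissibleLabeling F) : List U :=
  (List.finRange (Fintype.card U)).tail.map L.label.symm

/-- For a list of nodes `v₁, …, v_m`, the iterated integral
`∫ ⋯ ∫ f(x) d deg(x_{parent v_m})(x_{v_m}) ⋯ d deg(x_{parent v₁})(x_{v₁})`; the integral over
`x_{v₁}` is the outermost one. The coordinates of nodes not in the list are fixed. -/
def iteratedIntegral {U : Type*} [DecidableEq U] (deg : X → Measure X) (parent : U → U)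
    (f : (U → X) → ℝ≥0∞) : List U → (U → X) → ℝ≥0∞
  | [], x => f x
  | v :: l, x => ∫⁻ y, iteratedIntegral deg parent f l (Function.update x v y) ∂(deg (x (parent v)))

open Classical in
/-- The rooted homomorphism density `t((F, o), (P, x₀))`, computed with the admissible labeling `L`;
the root `o` is the node with label `0`. The product is over the edges of `F` that do not belong to
the spanning tree, each edge being listed once with the endpoint of smaller label first. -/
def PseudoGraphoningData.rootedDensity {U : Type*} [Fintype U] (P : PseudoGraphoningData X)
    {F : SimpleGraph U} (L : AdmissibleLabeling F) (x₀ : X) : ℝ≥0∞ :=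
  iteratedIntegral P.deg L.parent
    (fun x => ∏ e : U × U with
        F.Adj e.1 e.2 ∧ L.label e.1 < L.label e.2 ∧ e.1 ≠ L.parent e.2,
      ENNReal.ofReal (P.W (x e.1) (x e.2)))
    L.nonrootNodes (fun _ => x₀)

/-- The homomorphism density `t(F, P) = ∫ t((F, o), (P, x₀)) dλ(x₀)` of a connected graph `F` in a
pseudo-graphoning `P`, computed with the admissible labeling `L` of `F`. -/
def PseudoGraphoningData.density {U : Type*} [Fintype U] (P : PseudoGraphoningData X)
    {F : SimpleGraph U} (L : AdmissibleLabeling F) : ℝ≥0∞ :=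
  ∫⁻ x₀, P.rootedDensity L x₀ ∂P.lam

/-- `P` is a limit of the convergent sequence `(G n, d n)`: it is a pseudo-graphoning, and
`t(F, G n, d n) → t(F, P)` for all connected finite graphs `F` (whatever root, admissible labeling
and spanning tree are used to compute `t(F, P)`). -/
structure IsLimit {V : ℕ → Type*} (G : ∀ n, SimpleGraph (V n)) (d : ℕ → ℝ)
    (P : PseudoGraphoningData X) : Prop where
  convergentSeq : IsConvergentSeq G d
  pseudo : P.IsPseudoGraphoning
  tendsto : ∀ (U : Type) [Fintype U] (F : SimpleGraph U), F.Connected →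
    ∀ L : AdmissibleLabeling F,
      Tendsto (fun n => ENNReal.ofReal (homDensity F (G n) (d n))) atTop (𝓝 (P.density L))

/-! ### Hausdorff and Euclidean graphonings and limits -/

/-- `h` is a gauge function: on some right neighborhood `[0, ε)` of `0` it is nonnegative,
nondecreasing and right-continuous. -/
def IsGauge (h : ℝ → ℝ) : Prop :=
  ∃ ε > 0, (∀ x ∈ Set.Ico 0 ε, 0 ≤ h x) ∧ MonotoneOn h (Set.Ico 0 ε) ∧
    ∀ x ∈ Set.Ico 0 ε, ContinuousWithinAt h (Set.Ici x) x

/-- The Hausdorff measure with gauge function `h`: the limit as `δ → 0` of the infimum of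
`∑ h(diam I_i)` over the countable covers by sets `I_i` of diameter at most `δ`. -/
def gaugeMeasure (Y : Type*) [MetricSpace Y] [MeasurableSpace Y] [BorelSpace Y] (h : ℝ → ℝ) :
    Measure Y :=
  Measure.mkMetric (fun r : ℝ≥0∞ => ENNReal.ofReal (h r.toReal))

/-- `D` is a Hausdorff graphoning with gauge function `h`. -/
structure GraphoningData.IsHausdorff {Y : Type*} [MetricSpace Y] [MeasurableSpace Y] [BorelSpace Y]
    (D : GraphoningData Y) (h : ℝ → ℝ) : Prop where
  graphoning : D.IsGraphoning
  gauge : IsGauge h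
  lam_eq : D.lam = μH[1]
  mu_eq : D.mu = gaugeMeasure Y h

/-- `D` is a Euclidean limit of `(G n, d n)`, with gauge function `h`: `D` is a limit of the
convergent sequence `(G n, d n)`, it is a Hausdorff graphoning on `[0, 1]` with the Euclidean metric
with gauge function `h`, and `h(1 / v(G n)) ∼ 1 / d n`. -/
structure IsEuclideanLimit {V : ℕ → Type*} (G : ∀ n, SimpleGraph (V n)) (d : ℕ → ℝ)
    (D : GraphoningData unitInterval) (h : ℝ → ℝ) : Prop where
  limit : IsLimit G d D.toPseudo
  euclidean : D.IsHausdorff h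
  growth : Asymptotics.IsEquivalent atTop
    (fun n => h (1 / (Nat.card (V n) : ℝ))) (fun n => 1 / d n)

/-! ### The two examples -/

/-- The hypercube graph `Q_d` on `{0, 1}^d`. -/
def hypercube (d : ℕ) : SimpleGraph (Fin d → Fin 2) where
  Adj x y := hammingDist x y = 1
  symm := ⟨fun x y h => by rwa [hammingDist_comm]⟩
  loopless := ⟨fun x h => by simp at h⟩

/-- The bipartite point-line incidence graph. -/
def incidenceGraph (P L : Type*) [Membership P L] : SimpleGraph (P ⊕ L) :=
  SimpleGraph.fromRel fun a b =>
    match a, b with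
    | Sum.inl p, Sum.inr l => p ∈ l
    | _, _ => False

/-- The gauge function `1 / log₂ (1 / x)` (its value at `0` is `0`). -/
def hCube (x : ℝ) : ℝ := 1 / Real.logb 2 (1 / x)

/-- The gauge function `√(2 x)`. -/
def hProj (x : ℝ) : ℝ := √(2 * x)

/-- The numbers `∑_{j ≥ 1} a_j 2^{-j}` with binary digits satisfying `a_1 = a_2`, `a_3 = a_4`,
`a_5 = ⋯ = a_8`, `a_9 = ⋯ = a_16`, …. -/
def SCube : Set ℝ :=
  {s | ∃ a : ℕ → Fin 2, a 1 = a 2 ∧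
    (∀ k ≥ 1, ∀ i ∈ Set.Ioc (2 ^ k) (2 ^ (k + 1)), ∀ j ∈ Set.Ioc (2 ^ k) (2 ^ (k + 1)),
      a i = a j) ∧
    HasSum (fun j : ℕ => ((a (j + 1) : ℕ) : ℝ) * (1 / 2) ^ (j + 1)) s}

/-- The numbers `∑_{j ≥ 1} a_j 2^{-j}` with binary digits satisfying `a_1 = a_2 = a_3`,
`a_4 = a_5`, `a_6 = a_7`, `a_8 = a_9`, …. -/
def SProj : Set ℝ :=
  {s | ∃ a : ℕ → Fin 2, a 1 = a 2 ∧ a 2 = a 3 ∧ (∀ k ≥ 2, a (2 * k) = a (2 * k + 1)) ∧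
    HasSum (fun j : ℕ => ((a (j + 1) : ℕ) : ℝ) * (1 / 2) ^ (j + 1)) s}

/-- The tuple `([0, 1], 𝓑, λ, μ, W)` with `λ` Lebesgue measure, `μ` the Hausdorff measure with gauge
function `h`, and `W(x, y) = 1` if `|x - y| ∈ S` and `W(x, y) = 0` otherwise. -/
def differenceGraphoning (S : Set ℝ) (h : ℝ → ℝ) : GraphoningData unitInterval where
  lam := volume
  mu := gaugeMeasure unitInterval h
  W x y := S.indicator (fun _ => (1 : ℝ)) |(x : ℝ) - (y : ℝ)|

end

end GraphLimits

/-!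
Two distinct nodes of `Q_d`, or of an incidence graph of a projective plane, have at most `2`,
resp. `1` common neighbors, while the degree tends to infinity. In a connected graph `F` every edge
outside a spanning tree confines one node to the common neighborhood of two others, unless these
have the same image, which is rare. So the densities of all connected graphs that are not trees tend
to `0`, and those of trees are `1` by regularity. Hence any graphoning with all degrees equal to `1`
and almost disjoint neighborhoods is a limit.

Both sets `S` are Cantor sets `{∑ b_j (e_j - e_{j+1}) : b_j ∈ {0, 1}}`, where `e_j = 2⁻ⁿ` with `n`
the end of the `j`-th block of digits, and `h (e_j) = 2⁻ʲ` for `j ≥ 1`. Therefore `μ_h` restricted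
to `S` is the distribution of the sum for independent fair bits `b_j`: covering by cylinders gives
`μ_h S ≤ 1`, and the mass distribution principle the converse, where a weak concavity of `h` yields
the exact constant. The symmetry `b_j ↦ 1 - b_j` makes all degrees `1`. If `x - y` is irrational,
every point of `(x + S) ∩ (y + S)` has infinitely many prescribed bits, so that the neighborhoods of
`x` and `y` are almost disjoint.
-/

namespace GraphLimits

/-! ### Iterated integrals along a tree -/

section IteratedIntegral

variable {X : Type*} [MeasurableSpace X] {U : Type*} [DecidableEq U] {deg : X → Measure X}
  {parent : U → U} {f g : (U → X) → ℝ≥0∞} {l : List U}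

lemma iteratedIntegral_append (l₁ l₂ : List U) :
    iteratedIntegral deg parent f (l₁ ++ l₂) =
      iteratedIntegral deg parent (iteratedIntegral deg parent f l₂) l₁ := by
  induction l₁ with
  | nil => rfl
  | cons v l ih =>
    funext x
    simp only [List.cons_append, iteratedIntegral, ih]

lemma iteratedIntegral_mono (hfg : ∀ x, f x ≤ g x) (l : List U) (x : U → X) :
    iteratedIntegral deg parent f l x ≤ iteratedIntegral deg parent g l x := by
  induction l generalizing x with
  | nil => exact hfg x
  | cons v l ih => exact lintegral_mono fun y => ih _

lemma iteratedIntegral_const (hdeg : ∀ x, deg x Set.univ = 1) (c : ℝ≥0∞) (x : U → X) :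
    iteratedIntegral deg parent (fun _ => c) l x = c := by
  induction l generalizing x with
  | nil => rfl
  | cons v l ih => simp only [iteratedIntegral, ih, lintegral_const, hdeg, mul_one]

lemma iteratedIntegral_const_add_le (hdeg : ∀ x, deg x Set.univ ≤ 1) (c : ℝ≥0∞) (x : U → X) :
    iteratedIntegral deg parent (fun x => c + f x) l x ≤ c + iteratedIntegral deg parent f l x := by
  induction l generalizing x with
  | nil => exact le_rfl
  | cons v l ih =>
    calc iteratedIntegral deg parent (fun x => c + f x) (v :: l) x
        ≤ ∫⁻ y, (c + iteratedIntegral deg parent f l (Function.update x v y))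
            ∂(deg (x (parent v))) := lintegral_mono fun y => ih _
      _ = c * deg (x (parent v)) Set.univ + iteratedIntegral deg parent f (v :: l) x := by
          rw [lintegral_add_left measurable_const, lintegral_const]
          rfl
      _ ≤ c + iteratedIntegral deg parent f (v :: l) x := by
          gcongr
          exact mul_le_of_le_one_right' (hdeg _)

lemma iteratedIntegral_le_self (hdeg : ∀ x, deg x Set.univ ≤ 1)
    (hf : ∀ v ∈ l, ∀ x y, f (Function.update x v y) = f x) (x : U → X) :
    iteratedIntegral deg parent f l x ≤ f x := by
  induction l generalizing x with
  | nil => exact le_rfl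
  | cons v l ih =>
    calc iteratedIntegral deg parent f (v :: l) x
        ≤ ∫⁻ _, f x ∂(deg (x (parent v))) := by
          refine lintegral_mono fun y => ?_
          rw [← hf v List.mem_cons_self x y]
          exact ih (fun w hw => hf w (List.mem_cons_of_mem _ hw)) _
      _ ≤ f x := by
          rw [lintegral_const]
          exact mul_le_of_le_one_right' (hdeg _)

lemma iteratedIntegral_le_const (hdeg : ∀ x, deg x Set.univ ≤ 1) {c : ℝ≥0∞} (hf : ∀ x, f x ≤ c)
    (x : U → X) : iteratedIntegral deg parent f l x ≤ c :=
  (iteratedIntegral_mono hf l x).trans <|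
    iteratedIntegral_le_self (f := fun _ => c) hdeg (fun _ _ _ _ => rfl) x

lemma iteratedIntegral_cons_indicator_rel_le (hdeg : ∀ x, deg x Set.univ ≤ 1) {a b : U}
    (hb : b ∉ l) (ha : a ∉ b :: l) (R : X → X → Prop) (x : U → X) :
    iteratedIntegral deg parent ({x | R (x a) (x b)}.indicator 1) (b :: l) x ≤
      deg (x (parent b)) {y | R (x a) y} := by
  obtain ⟨hab, hal⟩ := not_or.1 (List.mem_cons.not.1 ha)
  have hindep : ∀ w ∈ l, ∀ (x : U → X) y, {x : U → X | R (x a) (x b)}.indicator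
      (1 : (U → X) → ℝ≥0∞) (Function.update x w y) = {x : U → X | R (x a) (x b)}.indicator 1 x := by
    classical
    intro w hw x y
    simp only [Set.indicator_apply, Set.mem_ofPred_eq, Pi.one_apply,
      Function.update_of_ne (ne_of_mem_of_not_mem hw hal).symm,
      Function.update_of_ne (ne_of_mem_of_not_mem hw hb).symm]
  calc iteratedIntegral deg parent ({x | R (x a) (x b)}.indicator 1) (b :: l) x
      ≤ ∫⁻ y, {x : U → X | R (x a) (x b)}.indicator (1 : (U → X) → ℝ≥0∞) (Function.update x b y)
          ∂(deg (x (parent b))) :=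
        lintegral_mono fun y => iteratedIntegral_le_self hdeg hindep _
    _ = ∫⁻ y, {y | R (x a) y}.indicator 1 y ∂(deg (x (parent b))) := by
        classical
        simp only [Set.indicator_apply, Set.mem_ofPred_eq, Function.update_of_ne hab,
          Function.update_self, Pi.one_apply]
    _ ≤ deg (x (parent b)) {y | R (x a) y} := lintegral_indicator_one_le _

lemma iteratedIntegral_indicator_rel_le_of_pairwise {ι : Type*} [Preorder ι] {label : U → ι}
    (hdeg : ∀ x, deg x Set.univ ≤ 1) (hl : l.Pairwise fun u v => label u < label v) {a b : U}
    (hb : b ∈ l) (hab : label a < label b) {R : X → X → Prop} {ε : ℝ≥0∞}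
    (hR : ∀ x z, deg x {y | R z y} ≤ ε) (x : U → X) :
    iteratedIntegral deg parent ({x | R (x a) (x b)}.indicator 1) l x ≤ ε := by
  obtain ⟨l₁, l₂, rfl⟩ := List.append_of_mem hb
  have hl₂ : ∀ u ∈ l₂, label b < label u :=
    (List.pairwise_cons.1 (List.pairwise_append.1 hl).2.1).1
  have ha : a ∉ b :: l₂ := by
    rintro (_ | ⟨_, h⟩)
    · exact lt_irrefl _ hab
    · exact lt_asymm hab (hl₂ a h)
  rw [iteratedIntegral_append]
  exact iteratedIntegral_le_const hdeg (fun x => (iteratedIntegral_cons_indicator_rel_le hdeg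
    (fun h => lt_irrefl _ (hl₂ b h)) ha R x).trans (hR _ _)) x

end IteratedIntegral

namespace AdmissibleLabeling

variable {U : Type*} [Fintype U] {F : SimpleGraph U} (L : AdmissibleLabeling F)

lemma mem_nonrootNodes {v : U} : v ∈ L.nonrootNodes ↔ 0 < (L.label v : ℕ) := by
  have hmem : ∀ {n : ℕ} {i : Fin n}, i ∈ (List.finRange n).tail ↔ 0 < (i : ℕ) := by
    rintro (_ | n) i
    · exact i.elim0
    · simp [List.finRange_succ, Fin.exists_succ_eq, Nat.pos_iff_ne_zero]
  rw [nonrootNodes, List.mem_map]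
  constructor
  · rintro ⟨i, hi, rfl⟩
    rwa [Equiv.apply_symm_apply, ← hmem]
  · exact fun hv => ⟨L.label v, hmem.2 hv, L.label.symm_apply_apply v⟩

lemma pairwise_nonrootNodes : L.nonrootNodes.Pairwise fun u v => L.label u < L.label v := by
  rw [nonrootNodes, List.pairwise_map]
  simpa only [Equiv.apply_symm_apply] using
    (List.pairwise_lt_finRange (Fintype.card U)).sublist (List.tail_sublist _)

lemma length_nonrootNodes : L.nonrootNodes.length = Fintype.card U - 1 := by
  simp [nonrootNodes]

lemma exists_nonrootNodes_eq_append {v : U} (hv : 0 < (L.label v : ℕ)) :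
    ∃ l₁ l₂, L.nonrootNodes = l₁ ++ v :: l₂ ∧ (∀ u ∈ l₂, L.label v < L.label u) ∧
      (∀ u, 0 < (L.label u : ℕ) → L.label u < L.label v → u ∈ l₁) ∧
      l₁.Pairwise (fun u v => L.label u < L.label v) := by
  obtain ⟨l₁, l₂, hl⟩ := List.append_of_mem (L.mem_nonrootNodes.2 hv)
  have hsorted := L.pairwise_nonrootNodes
  rw [hl, List.pairwise_append, List.pairwise_cons] at hsorted
  obtain ⟨hl₁, ⟨hl₂, -⟩, -⟩ := hsorted
  refine ⟨l₁, l₂, hl, hl₂, fun u hu huv => ?_, hl₁⟩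
  rw [← L.mem_nonrootNodes, hl, List.mem_append, List.mem_cons] at hu
  rcases hu with hu | rfl | hu
  · exact hu
  · exact absurd huv (lt_irrefl _)
  · exact absurd (hl₂ u hu) huv.not_gt

/-- The pair `e` is an edge of `F`, with the endpoint of smaller label first, that does not belong
to the spanning tree of the labeling. -/
def IsNontreeEdge (e : U × U) : Prop :=
  F.Adj e.1 e.2 ∧ L.label e.1 < L.label e.2 ∧ e.1 ≠ L.parent e.2

end AdmissibleLabeling

/-! ### Densities under small codegrees -/

namespace PseudoGraphoningData

variable {X : Type*} [MeasurableSpace X] {P : PseudoGraphoningData X} {U : Type*} [Fintype U]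
  {F : SimpleGraph U} {L : AdmissibleLabeling F}

lemma density_eq_one_of_forall_not_isNontreeEdge (hlam : P.lam Set.univ = 1)
    (hdeg : ∀ x, P.deg x Set.univ = 1) (hL : ∀ e, ¬ L.IsNontreeEdge e) : P.density L = 1 := by
  have hroot : ∀ x, P.rootedDensity L x = 1 := fun x => by
    classical
    have hempty : (Finset.univ.filter fun e : U × U =>
        F.Adj e.1 e.2 ∧ L.label e.1 < L.label e.2 ∧ e.1 ≠ L.parent e.2) = ∅ :=
      Finset.filter_eq_empty_iff.2 fun e _ => hL e
    simp only [rootedDensity, hempty, Finset.prod_empty]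
    exact iteratedIntegral_const hdeg _ _
  simp only [density, hroot, lintegral_const, hlam, mul_one]

open Classical in
lemma rootedDensity_le_iteratedIntegral_of_isNontreeEdge
    (hW : ∀ x y, P.W x y ∈ Set.Icc (0 : ℝ) 1) {k v : U} (hkv : L.IsNontreeEdge (k, v)) (x₀ : X) :
    P.rootedDensity L x₀ ≤ iteratedIntegral P.deg L.parent
      ({x | P.W (x k) (x v) ≠ 0}.indicator 1) L.nonrootNodes (fun _ => x₀) := by
  refine iteratedIntegral_mono (fun x => ?_) _ _
  have hmem : (k, v) ∈ Finset.univ.filter fun e : U × U =>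
      F.Adj e.1 e.2 ∧ L.label e.1 < L.label e.2 ∧ e.1 ≠ L.parent e.2 := by
    rw [Finset.mem_filter]
    exact ⟨Finset.mem_univ _, hkv⟩
  have hle : ∀ e : U × U, ENNReal.ofReal (P.W (x e.1) (x e.2)) ≤ 1 := fun e =>
    ENNReal.ofReal_le_one.2 (hW _ _).2
  by_cases h0 : P.W (x k) (x v) = 0
  · exact (Finset.prod_eq_zero hmem (by simp only [h0, ENNReal.ofReal_zero])).trans_le zero_le
  · rw [Set.indicator_of_mem (by exact h0)]
    exact Finset.prod_le_one' fun e _ => hle e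

/-- All codegrees of `P` are at most `ε`, outside an exceptional symmetric relation `R` of degree
at most `ε`: almost no points are related to a given point, and the neighborhoods of two unrelated
points are almost disjoint. For finite graphs `R` is equality; for the graphonings of Cantor sets
it is having a rational difference. -/
structure CodegreeBound (P : PseudoGraphoningData X) (R : X → X → Prop) (ε : ℝ≥0∞) : Prop where
  symm : ∀ x y, R x y → R y x
  deg_rel_le : ∀ x z, P.deg x {y | R z y} ≤ ε
  codegree_le : ∀ x z, ¬ R z x → P.deg x {y | P.W z y ≠ 0} ≤ ε

namespace CodegreeBound

variable {R : X → X → Prop} {ε : ℝ≥0∞}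

lemma iteratedIntegral_cons_le {U : Type*} [DecidableEq U] (h : P.CodegreeBound R ε)
    (hdeg : ∀ x, P.deg x Set.univ ≤ 1) {parent : U → U} {k v : U} {l : List U} (hv : v ∉ l)
    (hk : k ∉ v :: l) (x : U → X) :
    iteratedIntegral P.deg parent ({x | P.W (x k) (x v) ≠ 0}.indicator 1) (v :: l) x ≤
      ε + {x | R (x k) (x (parent v))}.indicator 1 x := by
  refine (iteratedIntegral_cons_indicator_rel_le hdeg hv hk (fun a b => P.W a b ≠ 0) x).trans ?_
  by_cases hr : R (x k) (x (parent v))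
  · rw [Set.indicator_of_mem (by exact hr)]
    exact ((measure_mono (Set.subset_univ _)).trans (hdeg _)).trans le_add_self
  · exact (h.codegree_le _ _ hr).trans le_self_add

lemma iteratedIntegral_rel_le [DecidableEq U] (h : P.CodegreeBound R ε)
    (hdeg : ∀ x, P.deg x Set.univ ≤ 1) {parent : U → U} {l : List U}
    (hl : l.Pairwise fun u v => L.label u < L.label v) {a b : U} (hab : a ≠ b)
    (ha : 0 < (L.label a : ℕ) → a ∈ l) (hb : 0 < (L.label b : ℕ) → b ∈ l) (x : U → X) :
    iteratedIntegral P.deg parent ({x | R (x a) (x b)}.indicator 1) l x ≤ ε := by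
  rcases lt_or_gt_of_ne (L.label.injective.ne hab) with hlt | hlt
  · exact iteratedIntegral_indicator_rel_le_of_pairwise hdeg hl
      (hb ((Nat.zero_le _).trans_lt hlt)) hlt h.deg_rel_le x
  · have hsymm : {x : U → X | R (x a) (x b)} = {x | R (x b) (x a)} :=
      Set.ext fun x => ⟨h.symm _ _, h.symm _ _⟩
    rw [hsymm]
    exact iteratedIntegral_indicator_rel_le_of_pairwise hdeg hl
      (ha ((Nat.zero_le _).trans_lt hlt)) hlt h.deg_rel_le x

/-- For a non-tree edge `(k, v)`, the point `x_v` is a neighbor of both `x_k` and `x_{parent v}`.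
Either these two points are unrelated, and `x_v` is confined to their common neighborhood, or they
are related, and the later one of them is confined to the points related to the earlier one. -/
lemma rootedDensity_le (h : P.CodegreeBound R ε) (hdeg : ∀ x, P.deg x Set.univ ≤ 1)
    (hW : ∀ x y, P.W x y ∈ Set.Icc (0 : ℝ) 1) {k v : U} (hkv : L.IsNontreeEdge (k, v)) (x₀ : X) :
    P.rootedDensity L x₀ ≤ 2 * ε := by
  classical
  refine (rootedDensity_le_iteratedIntegral_of_isNontreeEdge hW hkv x₀).trans ?_
  obtain ⟨-, hlt : L.label k < L.label v, hne : k ≠ L.parent v⟩ := hkv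
  have hv : 0 < (L.label v : ℕ) := (Nat.zero_le _).trans_lt hlt
  obtain ⟨l₁, l₂, hl, hl₂, hmem, hl₁⟩ := L.exists_nonrootNodes_eq_append hv
  have hv₂ : v ∉ l₂ := fun h => lt_irrefl _ (hl₂ v h)
  have hk₂ : k ∉ v :: l₂ := by
    rintro (_ | ⟨_, h⟩)
    · exact lt_irrefl _ hlt
    · exact lt_asymm hlt (hl₂ k h)
  rw [hl, iteratedIntegral_append]
  calc _ ≤ iteratedIntegral P.deg L.parent
        (fun x => ε + {x | R (x k) (x (L.parent v))}.indicator 1 x) l₁ (fun _ => x₀) :=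
        iteratedIntegral_mono (h.iteratedIntegral_cons_le hdeg hv₂ hk₂) _ _
    _ ≤ ε + iteratedIntegral P.deg L.parent
        ({x | R (x k) (x (L.parent v))}.indicator 1) l₁ (fun _ => x₀) :=
        iteratedIntegral_const_add_le hdeg _ _
    _ ≤ ε + ε := by
        gcongr
        exact h.iteratedIntegral_rel_le hdeg hl₁ hne (fun hk => hmem k hk hlt)
          (fun hp => hmem _ hp (L.parent_lt v hv)) _
    _ = 2 * ε := (two_mul ε).symm

lemma density_le (h : P.CodegreeBound R ε) (hlam : P.lam Set.univ ≤ 1)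
    (hdeg : ∀ x, P.deg x Set.univ ≤ 1) (hW : ∀ x y, P.W x y ∈ Set.Icc (0 : ℝ) 1) {e : U × U}
    (he : L.IsNontreeEdge e) : P.density L ≤ 2 * ε :=
  calc P.density L ≤ ∫⁻ _, 2 * ε ∂P.lam := lintegral_mono (h.rootedDensity_le hdeg hW he)
    _ ≤ 2 * ε := by
      rw [lintegral_const]
      exact mul_le_of_le_one_right' hlam

end CodegreeBound

end PseudoGraphoningData

/-! ### Finite graphs -/

section TreeExtension

variable {U V : Type*} {G : SimpleGraph V} {parent : U → U} {x g : U → V}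

/-- The map `g` arises from `x` by moving the nodes in `l`, each of them to a neighbor of the image
of its parent. These maps are the ones over which the iterated integrals of a finite graph sum. -/
def IsTreeExtension (G : SimpleGraph V) (parent : U → U) (l : List U) (x g : U → V) : Prop :=
  (∀ v, v ∉ l → g v = x v) ∧ ∀ v ∈ l, G.Adj (g (parent v)) (g v)

lemma isTreeExtension_nil :
    IsTreeExtension G parent [] x g ↔ g = x := by
  simp [IsTreeExtension, funext_iff]

lemma isTreeExtension_cons [DecidableEq U] {v : U} {l : List U} (hv : v ∉ l)
    (hp : parent v ∉ v :: l) :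
    IsTreeExtension G parent (v :: l) x g ↔
      G.Adj (x (parent v)) (g v) ∧ IsTreeExtension G parent l (Function.update x v (g v)) g := by
  have hext : (∀ u, u ∉ v :: l → g u = x u) ↔
      ∀ u, u ∉ l → g u = Function.update x v (g v) u := by
    refine forall_congr' fun u => ?_
    by_cases huv : u = v
    · simp [huv, hv]
    · simp [huv]
  rw [IsTreeExtension, IsTreeExtension, ← hext, List.forall_mem_cons]
  constructor
  · rintro ⟨hx, hadj, hl⟩
    exact ⟨hx _ hp ▸ hadj, hx, hl⟩
  · rintro ⟨hadj, hx, hl⟩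
    exact ⟨hx, (hx _ hp).symm ▸ hadj, hl⟩

end TreeExtension

section GraphData

variable {V : Type*} [Fintype V] [MeasurableSpace V] {U : Type*}

open Classical in
/-- A finite graph as a pseudo-graphoning: the nodes have equal probabilities, and the measure
`deg x` counts the neighbors of `x` with weight `1 / d`. -/
noncomputable def graphData (G : SimpleGraph V) (d : ℕ) : PseudoGraphoningData V where
  lam := (Fintype.card V : ℝ≥0∞)⁻¹ • Measure.count
  W x y := if G.Adj x y then 1 else 0
  deg x := (d : ℝ≥0∞)⁻¹ • Measure.count.restrict {y | G.Adj x y}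

variable {G : SimpleGraph V} {d : ℕ}

lemma graphData_W_mem_Icc (x y : V) : (graphData G d).W x y ∈ Set.Icc (0 : ℝ) 1 := by
  simp only [graphData]
  split_ifs <;> simp

lemma graphData_W_ne_zero_iff {x y : V} : (graphData G d).W x y ≠ 0 ↔ G.Adj x y := by
  simp [graphData]

lemma graphData_lam_univ [Nonempty V] : (graphData G d).lam Set.univ = 1 := by
  rw [graphData, Measure.smul_apply, Measure.count_univ, ENat.card_eq_coe_fintype_card,
    smul_eq_mul]
  exact ENNReal.inv_mul_cancel (by simp) (by simp)

open Classical in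
lemma prod_graphData_W [Fintype U] {F : SimpleGraph U} (L : AdmissibleLabeling F)
    (g : U → V) :
    (∏ e : U × U with F.Adj e.1 e.2 ∧ L.label e.1 < L.label e.2 ∧ e.1 ≠ L.parent e.2,
      ENNReal.ofReal ((graphData G d).W (g e.1) (g e.2))) =
      if ∀ e, L.IsNontreeEdge e → G.Adj (g e.1) (g e.2) then 1 else 0 := by
  split_ifs with h
  · refine Finset.prod_eq_one fun e he => ?_
    simp [graphData, h e (Finset.mem_filter.1 he).2]
  · push Not at h
    obtain ⟨e, he, hg⟩ := h
    exact Finset.prod_eq_zero (Finset.mem_filter.2 ⟨Finset.mem_univ e, he⟩)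
      (by simp [graphData, hg])

variable [MeasurableSingletonClass V]

lemma lintegral_graphData_lam (f : V → ℝ≥0∞) :
    ∫⁻ x, f x ∂(graphData G d).lam = (Fintype.card V : ℝ≥0∞)⁻¹ * ∑ x, f x := by
  rw [graphData, lintegral_smul_measure, lintegral_count, tsum_fintype, smul_eq_mul]

open Classical in
lemma lintegral_graphData_deg (x : V) (f : V → ℝ≥0∞) :
    ∫⁻ y, f y ∂((graphData G d).deg x) = (d : ℝ≥0∞)⁻¹ * ∑ y with G.Adj x y, f y := by
  rw [graphData, lintegral_smul_measure, ← lintegral_indicator (Set.toFinite _).measurableSet,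
    lintegral_count, tsum_fintype, smul_eq_mul, Finset.sum_filter]
  simp only [Set.indicator_apply, Set.mem_ofPred_eq]

lemma graphData_deg_apply (x : V) (A : Set V) :
    (graphData G d).deg x A = ((A ∩ G.neighborSet x).ncard : ℝ≥0∞) / d := by
  rw [graphData, Measure.smul_apply, Measure.restrict_apply (Set.toFinite _).measurableSet,
    Measure.count_apply (Set.toFinite _).measurableSet, smul_eq_mul, ENNReal.div_eq_inv_mul,
    ← (Set.toFinite _).cast_ncard_eq, ENat.toENNReal_coe]
  rfl

open Classical in
lemma iteratedIntegral_graphData [Fintype U] {F : SimpleGraph U} (L : AdmissibleLabeling F)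
    (f : (U → V) → ℝ≥0∞) {l : List U} (hl : l.Pairwise fun u v => L.label u < L.label v)
    (hpos : ∀ v ∈ l, 0 < (L.label v : ℕ)) (x : U → V) :
    iteratedIntegral (graphData G d).deg L.parent f l x =
      (d : ℝ≥0∞)⁻¹ ^ l.length * ∑ g with IsTreeExtension G L.parent l x g, f g := by
  induction l generalizing x with
  | nil => simp [iteratedIntegral, isTreeExtension_nil, Finset.filter_eq']
  | cons v l ih =>
    obtain ⟨hvlt, hl⟩ := List.pairwise_cons.1 hl
    have hvl : v ∉ l := fun h => lt_irrefl _ (hvlt _ h)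
    have hplt := L.parent_lt v (hpos v List.mem_cons_self)
    have hp : L.parent v ∉ v :: l := by
      rw [List.mem_cons]
      rintro (h | h)
      · exact hplt.ne (congrArg L.label h)
      · exact lt_asymm hplt (hvlt _ h)
    have hself : ∀ {g : U → V} {y : V},
        IsTreeExtension G L.parent l (Function.update x v y) g → y = g v :=
      fun h => by simpa using (h.1 v hvl).symm
    rw [iteratedIntegral, lintegral_graphData_deg, List.length_cons, pow_succ', mul_assoc]
    simp only [ih hl (fun u hu => hpos u (List.mem_cons_of_mem _ hu)), ← Finset.mul_sum]
    congr 2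
    rw [Finset.sum_sigma']
    refine Finset.sum_bij' (fun p _ => p.2) (fun g _ => ⟨g v, g⟩) ?_ ?_ ?_ ?_ ?_
    · rintro ⟨y, g⟩ h
      simp only [Finset.mem_sigma, Finset.mem_filter_univ] at h
      obtain rfl := hself h.2
      simpa only [Finset.mem_filter_univ, isTreeExtension_cons hvl hp] using h
    · intro g h
      simpa only [Finset.mem_sigma, Finset.mem_filter_univ, isTreeExtension_cons hvl hp] using h
    · rintro ⟨y, g⟩ h
      simp only [Finset.mem_sigma, Finset.mem_filter_univ] at h
      obtain rfl := hself h.2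
      rfl
    · exact fun _ _ => rfl
    · exact fun _ _ => rfl

end GraphData

lemma AdmissibleLabeling.forall_adj_iff {U V : Type*} [Fintype U] {F : SimpleGraph U}
    (L : AdmissibleLabeling F) {G : SimpleGraph V} {g : U → V} :
    (∀ u v, F.Adj u v → G.Adj (g u) (g v)) ↔
      (∀ v ∈ L.nonrootNodes, G.Adj (g (L.parent v)) (g v)) ∧
        ∀ e, L.IsNontreeEdge e → G.Adj (g e.1) (g e.2) := by
  constructor
  · exact fun h => ⟨fun v hv => h _ _ (L.parent_adj v (L.mem_nonrootNodes.1 hv)),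
      fun e he => h _ _ he.1⟩
  · rintro ⟨htree, hnontree⟩
    have hadj : ∀ u v, L.label u < L.label v → F.Adj u v → G.Adj (g u) (g v) := by
      intro u v hlt huv
      by_cases hup : u = L.parent v
      · exact hup ▸ htree v (L.mem_nonrootNodes.2 ((Nat.zero_le _).trans_lt hlt))
      · exact hnontree (u, v) ⟨huv, hlt, hup⟩
    intro u v huv
    rcases lt_or_gt_of_ne (L.label.injective.ne huv.ne) with h | h
    · exact hadj u v h huv
    · exact (hadj v u h huv.symm).symm

section Density

variable {V : Type*} [Fintype V] [MeasurableSpace V] [MeasurableSingletonClass V]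
  {G : SimpleGraph V} {d : ℕ} {U : Type*} [Fintype U] {F : SimpleGraph U}

open Classical in
lemma rootedDensity_graphData (L : AdmissibleLabeling F) {r : U} (hr : (L.label r : ℕ) = 0)
    (x₀ : V) : (graphData G d).rootedDensity L x₀ =
      (d : ℝ≥0∞)⁻¹ ^ (Fintype.card U - 1) * ∑ g : U → V,
        if g r = x₀ then (if ∀ u v, F.Adj u v → G.Adj (g u) (g v) then 1 else 0) else 0 := by
  have hroot : ∀ v, v ∉ L.nonrootNodes ↔ v = r := fun v => by
    rw [L.mem_nonrootNodes, Nat.pos_iff_ne_zero, not_not, ← L.label.injective.eq_iff, Fin.ext_iff,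
      hr]
  rw [PseudoGraphoningData.rootedDensity, iteratedIntegral_graphData L _ L.pairwise_nonrootNodes
    (fun v => L.mem_nonrootNodes.1), L.length_nonrootNodes, Finset.sum_filter]
  congr 1
  refine Finset.sum_congr rfl fun g _ => ?_
  rw [prod_graphData_W, ← ite_and, ← ite_and]
  refine if_congr ?_ rfl rfl
  simp only [IsTreeExtension, hroot, forall_eq, L.forall_adj_iff, and_assoc]

open Classical in
lemma card_hom_eq_sum (F : SimpleGraph U) {V : Type*} [Fintype V] (G : SimpleGraph V) :
    (Nat.card (F →g G) : ℝ≥0∞) =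
      ∑ g : U → V, if ∀ u v, F.Adj u v → G.Adj (g u) (g v) then 1 else 0 := by
  let homEquivSubtype : (F →g G) ≃ {g : U → V // ∀ u v, F.Adj u v → G.Adj (g u) (g v)} :=
    ⟨fun φ => ⟨φ, fun u v h => φ.map_adj h⟩, fun g => ⟨g.1, fun h => g.2 _ _ h⟩,
      fun _ => rfl, fun _ => rfl⟩
  rw [Finset.sum_boole, Nat.card_congr homEquivSubtype, Nat.card_eq_fintype_card,
    Fintype.card_subtype]

lemma density_graphData_eq_card_hom [Nonempty U] (L : AdmissibleLabeling F) :
    (graphData G d).density L = (Fintype.card V : ℝ≥0∞)⁻¹ *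
      ((d : ℝ≥0∞)⁻¹ ^ (Fintype.card U - 1) * Nat.card (F →g G)) := by
  classical
  let r : U := L.label.symm ⟨0, Fintype.card_pos⟩
  have hr : (L.label r : ℕ) = 0 := by rw [Equiv.apply_symm_apply]
  rw [PseudoGraphoningData.density, lintegral_graphData_lam]
  congr 1
  simp_rw [rootedDensity_graphData L hr]
  rw [← Finset.mul_sum, Finset.sum_comm, card_hom_eq_sum]
  simp only [Finset.sum_ite_eq, Finset.mem_univ, if_true]

lemma card_connectedComponent_eq_one {U : Type*} {F : SimpleGraph U} (hF : F.Connected) :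
    Nat.card F.ConnectedComponent = 1 := by
  have := hF.preconnected.subsingleton_connectedComponent
  have := hF.nonempty
  exact Nat.card_unique

lemma density_graphData [Nonempty V] (hF : F.Connected) (L : AdmissibleLabeling F) (hd : 0 < d) :
    (graphData G d).density L = ENNReal.ofReal (homDensity F G d) := by
  have := hF.nonempty
  rw [density_graphData_eq_card_hom, homDensity, card_connectedComponent_eq_one hF, pow_one,
    Nat.card_eq_fintype_card (α := V), Nat.card_eq_fintype_card (α := U),
    ENNReal.ofReal_div_of_pos (by positivity), ENNReal.ofReal_mul (by positivity),
    ENNReal.ofReal_pow (by positivity), ENNReal.ofReal_natCast, ENNReal.ofReal_natCast,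
    ENNReal.ofReal_natCast, ENNReal.div_eq_inv_mul,
    ENNReal.mul_inv (Or.inr (by finiteness)) (Or.inl (by finiteness)), ENNReal.inv_pow, mul_assoc]

end Density

/-! ### Multiplicativity of homomorphism densities -/

lemma card_hom_eq_prod {U V : Type*} (F : SimpleGraph U) (G : SimpleGraph V)
    [Fintype F.ConnectedComponent] :
    Nat.card (F →g G) = ∏ c : F.ConnectedComponent, Nat.card (c.toSimpleGraph →g G) := by
  rw [← Nat.card_pi]
  refine Nat.card_congr ⟨fun φ c => φ.comp c.toSimpleGraph_hom, F.homOfConnectedComponents,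
    fun φ => rfl, fun ψ => ?_⟩
  funext c
  ext ⟨u, rfl⟩
  rfl

lemma homDensity_eq_prod {U V : Type*} [Finite U] (F : SimpleGraph U) (G : SimpleGraph V)
    (d : ℝ) [Fintype F.ConnectedComponent] :
    homDensity F G d = ∏ c : F.ConnectedComponent, homDensity c.toSimpleGraph G d := by
  have hcard : Nat.card U = ∑ c : F.ConnectedComponent, Nat.card c := by
    rw [← Nat.card_sigma]
    exact Nat.card_congr (Equiv.sigmaFiberEquiv F.connectedComponentMk).symm
  have hpos : ∀ c : F.ConnectedComponent, 1 ≤ Nat.card c := fun c =>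
    have := c.connected_toSimpleGraph.nonempty
    Nat.card_pos
  simp only [homDensity, fun c : F.ConnectedComponent =>
    card_connectedComponent_eq_one c.connected_toSimpleGraph, pow_one]
  rw [Finset.prod_div_distrib, Finset.prod_mul_distrib, Finset.prod_const,
    Finset.prod_pow_eq_pow_sum, card_hom_eq_prod, Nat.cast_prod, Finset.card_univ,
    Nat.card_eq_fintype_card (α := F.ConnectedComponent)]
  congr 3
  rw [hcard, Finset.sum_tsub_distrib _ fun c _ => hpos c, Finset.sum_const, Finset.card_univ,
    smul_eq_mul, mul_one]

/-! ### Sparse regular graphs and their limits -/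

/-- `G` is a finite `d`-regular graph in which two distinct nodes have at most `c` common
neighbors. Along a sequence of such graphs with `d → ∞` and `c` fixed, the codegrees vanish relative
to the degree. -/
structure IsSparseRegular {V : Type*} (G : SimpleGraph V) (d c : ℕ) : Prop where
  finite : Finite V
  nonempty : Nonempty V
  pos : 0 < d
  degree_eq : ∀ v, (G.neighborSet v).ncard = d
  codegree_le : ∀ u v, u ≠ v → (G.neighborSet u ∩ G.neighborSet v).ncard ≤ c

namespace IsSparseRegular

variable {V : Type*} {G : SimpleGraph V} {d c : ℕ}

lemma isAdmissible (h : IsSparseRegular G d c) : IsAdmissible G d where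
  finite := h.finite
  nonempty := h.nonempty
  one_le := by exact_mod_cast h.pos
  degree_le v := by rw [h.degree_eq v]

section GraphData

variable [Fintype V] [MeasurableSpace V] [MeasurableSingletonClass V]

lemma graphData_deg_univ (h : IsSparseRegular G d c) (x : V) :
    (graphData G d).deg x Set.univ = 1 := by
  rw [graphData_deg_apply, Set.univ_inter, h.degree_eq]
  exact ENNReal.div_self (by exact_mod_cast h.pos.ne') (ENNReal.natCast_ne_top d)

lemma codegreeBound (h : IsSparseRegular G d c) :
    (graphData G d).CodegreeBound Eq ((c + 1 : ℕ) / d) where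
  symm _ _ := Eq.symm
  deg_rel_le x z := by
    have hcard : ({y | z = y} ∩ G.neighborSet x).ncard ≤ c + 1 := by
      refine (Set.ncard_le_ncard (t := {z}) ?_).trans ?_
      · rintro y ⟨rfl, -⟩
        rfl
      · rw [Set.ncard_singleton]
        exact Nat.le_add_left 1 c
    rw [graphData_deg_apply]
    gcongr
  codegree_le x z hxz := by
    have hset : {y | (graphData G d).W z y ≠ 0} = G.neighborSet z :=
      Set.ext fun y => graphData_W_ne_zero_iff
    rw [graphData_deg_apply, hset]
    gcongr
    exact (h.codegree_le z x hxz).trans (Nat.le_succ c)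

end GraphData

variable {U : Type*} [Fintype U] {F : SimpleGraph U} {L : AdmissibleLabeling F}

lemma homDensity_eq_one (h : IsSparseRegular G d c) (hF : F.Connected)
    (hL : ∀ e, ¬ L.IsNontreeEdge e) : homDensity F G d = 1 := by
  have := h.finite
  have := h.nonempty
  have := Fintype.ofFinite V
  let _ : MeasurableSpace V := ⊤
  rw [← ENNReal.ofReal_eq_one, ← density_graphData hF L h.pos]
  exact PseudoGraphoningData.density_eq_one_of_forall_not_isNontreeEdge graphData_lam_univ
    h.graphData_deg_univ hL

lemma homDensity_le (h : IsSparseRegular G d c) (hF : F.Connected) {e : U × U}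
    (he : L.IsNontreeEdge e) : ENNReal.ofReal (homDensity F G d) ≤ 2 * ((c + 1 : ℕ) / d) := by
  have := h.finite
  have := h.nonempty
  have := Fintype.ofFinite V
  let _ : MeasurableSpace V := ⊤
  rw [← density_graphData hF L h.pos]
  exact h.codegreeBound.density_le graphData_lam_univ.le (fun x => (h.graphData_deg_univ x).le)
    graphData_W_mem_Icc he

end IsSparseRegular

section Limit

variable {V : ℕ → Type*} {G : ∀ n, SimpleGraph (V n)} {d : ℕ → ℕ} {c : ℕ}

open Classical in
lemma tendsto_homDensity_of_isSparseRegular (hG : ∀ n, IsSparseRegular (G n) (d n) c)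
    (hd : Tendsto d atTop atTop) {U : Type*} [Fintype U] {F : SimpleGraph U} (hF : F.Connected)
    (L : AdmissibleLabeling F) :
    Tendsto (fun n => ENNReal.ofReal (homDensity F (G n) (d n))) atTop
      (𝓝 (if ∃ e, L.IsNontreeEdge e then 0 else 1)) := by
  split_ifs with hL
  · obtain ⟨e, he⟩ := hL
    refine tendsto_of_tendsto_of_tendsto_of_le_of_le tendsto_const_nhds ?_ (fun _ => zero_le)
      (fun n => (hG n).homDensity_le hF he)
    have hinv : Tendsto (fun n => (d n : ℝ≥0∞)⁻¹) atTop (𝓝 0) :=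
      ENNReal.tendsto_inv_nat_nhds_zero.comp hd
    simpa [div_eq_mul_inv] using ENNReal.Tendsto.const_mul (a := 2)
      (ENNReal.Tendsto.const_mul (a := ((c + 1 : ℕ) : ℝ≥0∞)) hinv (Or.inr (by simp)))
      (Or.inr (by simp))
  · push Not at hL
    simp only [(hG _).homDensity_eq_one hF hL, ENNReal.ofReal_one, tendsto_const_nhds]

lemma isConvergentSeq_of_isSparseRegular (hG : ∀ n, IsSparseRegular (G n) (d n) c)
    (hd : Tendsto d atTop atTop) : IsConvergentSeq G fun n => (d n : ℝ) := by
  classical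
  refine ⟨fun n => (hG n).isAdmissible, fun U _ F => ?_⟩
  have := Fintype.ofFinite F.ConnectedComponent
  have hconn : ∀ C : F.ConnectedComponent, ∃ l : ℝ,
      Tendsto (fun n => homDensity C.toSimpleGraph (G n) (d n)) atTop (𝓝 l) := by
    intro C
    have := Fintype.ofFinite C
    obtain ⟨L⟩ := AdmissibleLabeling.nonempty C.connected_toSimpleGraph
    have hlim := tendsto_homDensity_of_isSparseRegular hG hd C.connected_toSimpleGraph L
    refine ⟨_, ((ENNReal.tendsto_toReal ?_).comp hlim).congr fun n => ?_⟩
    · split_ifs <;> simp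
    · exact ENNReal.toReal_ofReal (by rw [homDensity]; positivity)
  choose l hl using hconn
  simp_rw [homDensity_eq_prod F]
  exact ⟨_, tendsto_finsetProd _ fun C _ => hl C⟩

theorem isLimit_of_isSparseRegular (hG : ∀ n, IsSparseRegular (G n) (d n) c)
    (hd : Tendsto d atTop atTop) {X : Type*} [MeasurableSpace X] {P : PseudoGraphoningData X}
    (hP : P.IsPseudoGraphoning) (hdeg : ∀ x, P.deg x Set.univ = 1) {R : X → X → Prop}
    (hR : P.CodegreeBound R 0) : IsLimit G (fun n => (d n : ℝ)) P := by
  classical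
  refine ⟨isConvergentSeq_of_isSparseRegular hG hd, hP, fun U _ F hF L => ?_⟩
  have := hP.prob
  have hlim := tendsto_homDensity_of_isSparseRegular hG hd hF L
  split_ifs at hlim with hL
  · obtain ⟨e, he⟩ := hL
    have hzero : P.density L = 0 := nonpos_iff_eq_zero.1 <|
      (hR.density_le prob_le_one (fun x => (hdeg x).le) hP.W_mem he).trans_eq (mul_zero 2)
    rwa [hzero]
  · push Not at hL
    rwa [PseudoGraphoningData.density_eq_one_of_forall_not_isNontreeEdge measure_univ hdeg hL]

end Limit

/-! ### Hypercubes and incidence graphs of projective planes -/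

lemma hypercube_adj_iff {d : ℕ} {x y : Fin d → Fin 2} :
    (hypercube d).Adj x y ↔ ∃ i, y = Function.update x i (x i + 1) := by
  have hflip : ∀ a b : Fin 2, a ≠ b ↔ b = a + 1 := by decide
  change hammingDist x y = 1 ↔ _
  rw [hammingDist, Finset.card_eq_one]
  refine exists_congr fun i => ?_
  rw [Finset.ext_iff, Function.eq_update_iff]
  simp only [Finset.mem_filter_univ, Finset.mem_singleton]
  constructor
  · exact fun h => ⟨(hflip _ _).1 ((h i).2 rfl), fun j hj => by_contra fun hne =>
      hj ((h j).1 (Ne.symm hne))⟩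
  · rintro ⟨hi, hne⟩ j
    constructor
    · exact fun hj => by_contra fun hji => hj (hne j hji).symm
    · rintro rfl
      exact (hflip _ _).2 hi

lemma ncard_neighborSet_hypercube {d : ℕ} (x : Fin d → Fin 2) :
    ((hypercube d).neighborSet x).ncard = d := by
  have hrange : (hypercube d).neighborSet x = Set.range fun i => Function.update x i (x i + 1) := by
    ext y
    simp only [SimpleGraph.mem_neighborSet, hypercube_adj_iff, Set.mem_range, eq_comm]
  have hinj : Function.Injective fun i => Function.update x i (x i + 1) := by
    intro i j hij
    by_contra hne
    simpa [hne] using congrFun hij i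
  rw [hrange, ← Set.image_univ, Set.ncard_image_of_injective _ hinj, Set.ncard_univ, Nat.card_fin]

lemma ncard_neighborSet_inter_hypercube_le {d : ℕ} {x z : Fin d → Fin 2} (hxz : x ≠ z) :
    ((hypercube d).neighborSet x ∩ (hypercube d).neighborSet z).ncard ≤ 2 := by
  obtain ⟨j, hj⟩ := Function.ne_iff.1 hxz
  have hsubset : (hypercube d).neighborSet x ∩ (hypercube d).neighborSet z ⊆
      {Function.update x j (x j + 1), Function.update z j (z j + 1)} := by
    rintro y ⟨hx, hz⟩
    obtain ⟨i, hi⟩ := hypercube_adj_iff.1 hx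
    obtain ⟨i', hi'⟩ := hypercube_adj_iff.1 hz
    by_cases hij : i = j
    · exact Or.inl (hij ▸ hi)
    · by_cases hij' : i' = j
      · exact Or.inr (hij' ▸ hi')
      · have hy := congrFun (hi.symm.trans hi') j
        rw [Function.update_of_ne (Ne.symm hij), Function.update_of_ne (Ne.symm hij')] at hy
        exact absurd hy hj
  refine (Set.ncard_le_ncard hsubset).trans ((Set.ncard_insert_le _ _).trans ?_)
  rw [Set.ncard_singleton]

lemma isSparseRegular_hypercube {d : ℕ} (hd : 0 < d) : IsSparseRegular (hypercube d) d 2 where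
  finite := inferInstance
  nonempty := inferInstance
  pos := hd
  degree_eq := ncard_neighborSet_hypercube
  codegree_le _ _ := ncard_neighborSet_inter_hypercube_le

section Plane

open Configuration

variable {P L : Type*} [Membership P L]

lemma neighborSet_incidenceGraph_inl (p : P) :
    (incidenceGraph P L).neighborSet (Sum.inl p) = Sum.inr '' {l | p ∈ l} := by
  ext (p' | l) <;> simp [incidenceGraph]

lemma neighborSet_incidenceGraph_inr (l : L) :
    (incidenceGraph P L).neighborSet (Sum.inr l) = Sum.inl '' {p | p ∈ l} := by
  ext (p | l') <;> simp [incidenceGraph]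

lemma subsingleton_neighborSet_inter_incidenceGraph [Nondegenerate P L] {u v : P ⊕ L}
    (huv : u ≠ v) : ((incidenceGraph P L).neighborSet u ∩
      (incidenceGraph P L).neighborSet v).Subsingleton := by
  rcases u with p | l <;> rcases v with p' | l' <;>
    simp only [neighborSet_incidenceGraph_inl, neighborSet_incidenceGraph_inr]
  · rintro _ ⟨⟨l, hl, rfl⟩, hl'⟩ _ ⟨⟨m, hm, rfl⟩, hm'⟩
    rw [Sum.inr_injective.mem_set_image] at hl' hm'
    exact congrArg _ ((Nondegenerate.eq_or_eq (P := P) (L := L) hl hl' hm hm').resolve_left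
      fun h => huv (congrArg _ h))
  · rintro _ ⟨⟨l, -, rfl⟩, ⟨_, -, h⟩⟩
    simp at h
  · rintro _ ⟨⟨l, -, rfl⟩, ⟨_, -, h⟩⟩
    simp at h
  · rintro _ ⟨⟨p, hp, rfl⟩, hp'⟩ _ ⟨⟨q, hq, rfl⟩, hq'⟩
    rw [Sum.inl_injective.mem_set_image] at hp' hq'
    exact congrArg _ ((Nondegenerate.eq_or_eq (P := P) (L := L) hp hq hp' hq').resolve_right
      fun h => huv (congrArg _ h))

variable (P L) [Finite P] [Finite L] [ProjectivePlane P L]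

lemma isSparseRegular_incidenceGraph :
    IsSparseRegular (incidenceGraph P L) (ProjectivePlane.order P L + 1) 1 where
  finite := inferInstance
  nonempty := by
    obtain ⟨p, -⟩ := ProjectivePlane.exists_config (P := P) (L := L)
    exact ⟨Sum.inl p⟩
  pos := Nat.succ_pos _
  degree_eq v := by
    rcases v with p | l
    · rw [neighborSet_incidenceGraph_inl, Set.ncard_image_of_injective _ Sum.inr_injective]
      exact ProjectivePlane.lineCount_eq (P := P) (L := L) p
    · rw [neighborSet_incidenceGraph_inr, Set.ncard_image_of_injective _ Sum.inl_injective]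
      exact ProjectivePlane.pointCount_eq (P := P) (L := L) l
  codegree_le _ _ huv := Set.ncard_le_one_iff_subsingleton.2
    (subsingleton_neighborSet_inter_incidenceGraph huv)

lemma card_point_sum_line : Nat.card (P ⊕ L) =
    2 * (ProjectivePlane.order P L ^ 2 + ProjectivePlane.order P L + 1) := by
  have := Fintype.ofFinite P
  have := Fintype.ofFinite L
  rw [Nat.card_sum, Nat.card_eq_fintype_card, Nat.card_eq_fintype_card,
    ProjectivePlane.card_points P L, ProjectivePlane.card_lines P L, two_mul]

end Plane

/-! ### Series with gaps -/

/-- The sum `∑_{j ≥ k} b_j (e_j - e_{j+1})`, a tail of the generic point of a Cantor set whose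
intervals of the `j`-th generation have length `e_j`. -/
noncomputable def gapTail (e b : ℕ → ℝ) (k : ℕ) : ℝ :=
  ∑' j, b (j + k) * (e (j + k) - e (j + k + 1))

/-- All terms of the sequence `b` are `0` or `1`. The values are real numbers, so that such
sequences can serve as coefficients and be subtracted. -/
def IsBit (b : ℕ → ℝ) : Prop := ∀ k, b k = 0 ∨ b k = 1

namespace IsBit

variable {b : ℕ → ℝ}

lemma nonneg (hb : IsBit b) (k : ℕ) : 0 ≤ b k := by
  rcases hb k with h | h <;> simp [h]

lemma abs_le_one (hb : IsBit b) (k : ℕ) : |b k| ≤ 1 := by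
  rcases hb k with h | h <;> simp [h]

lemma one_sub (hb : IsBit b) : IsBit (1 - b) := fun k => by
  rcases hb k with h | h <;> simp [h]

lemma forall_eq_zero_or_exists_first (hb : IsBit b) (k : ℕ) :
    (∀ j, k ≤ j → b j = 0) ∨ ∃ i, k ≤ i ∧ b i = 1 ∧ ∀ j, k ≤ j → j < i → b j = 0 := by
  classical
  by_cases! hex : ∃ i, k ≤ i ∧ b i ≠ 0
  · obtain ⟨i, ⟨hki, hi⟩, hmin⟩ := Nat.findX hex
    exact .inr ⟨i, hki, (hb i).resolve_left hi, fun j hkj hji => by simpa [hkj] using hmin j hji⟩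
  · exact .inl hex

end IsBit

section Gap

variable {e : ℕ → ℝ} (he : Antitone e) {b c : ℕ → ℝ} {B C : ℝ}

include he

lemma gapTail_nonneg (hb : ∀ k, 0 ≤ b k) (k : ℕ) : 0 ≤ gapTail e b k :=
  tsum_nonneg fun _ => mul_nonneg (hb _) (sub_nonneg.2 (he (Nat.le_succ _)))

lemma norm_mul_gap_le (hb : ∀ k, |b k| ≤ B) (k : ℕ) :
    ‖b k * (e k - e (k + 1))‖ ≤ B * (e k - e (k + 1)) := by
  have hgap : 0 ≤ e k - e (k + 1) := sub_nonneg.2 (he k.le_succ)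
  rw [Real.norm_eq_abs, abs_mul, abs_of_nonneg hgap]
  exact mul_le_mul_of_nonneg_right (hb k) hgap

variable (hlim : Tendsto e atTop (𝓝 0))

include hlim

lemma hasSum_gap (k : ℕ) : HasSum (fun j => e (j + k) - e (j + k + 1)) (e k) := by
  rw [hasSum_iff_tendsto_nat_of_nonneg (fun _ => sub_nonneg.2 (he (Nat.le_succ _)))]
  have hpartial : ∀ n, ∑ j ∈ Finset.range n, (e (j + k) - e (j + k + 1)) = e k - e (n + k) := by
    intro n
    simpa only [zero_add, Nat.add_right_comm _ 1 k] using
      Finset.sum_range_sub' (fun j => e (j + k)) n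
  simp_rw [hpartial]
  simpa using tendsto_const_nhds.sub ((tendsto_add_atTop_iff_nat k).2 hlim)

lemma summable_mul_gap (hb : ∀ k, |b k| ≤ B) (k : ℕ) :
    Summable fun j => b (j + k) * (e (j + k) - e (j + k + 1)) :=
  .of_norm_bounded ((hasSum_gap he hlim k).summable.mul_left B) fun _ => norm_mul_gap_le he hb _

lemma abs_gapTail_le (hb : ∀ k, |b k| ≤ B) (k : ℕ) : |gapTail e b k| ≤ B * e k :=
  tsum_of_norm_bounded ((hasSum_gap he hlim k).mul_left B) fun _ => norm_mul_gap_le he hb _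

lemma IsBit.gapTail_le (hb : IsBit b) (k : ℕ) : gapTail e b k ≤ e k := by
  simpa using (le_abs_self _).trans (abs_gapTail_le he hlim hb.abs_le_one k)

lemma gapTail_eq_add (hb : ∀ k, |b k| ≤ B) (k : ℕ) :
    gapTail e b k = b k * (e k - e (k + 1)) + gapTail e b (k + 1) := by
  rw [gapTail, (summable_mul_gap he hlim hb k).tsum_eq_zero_add, zero_add]
  simp only [gapTail, Nat.add_right_comm _ 1 k, ← Nat.add_assoc]

lemma gapTail_sub (hb : ∀ k, |b k| ≤ B) (hc : ∀ k, |c k| ≤ C) (k : ℕ) :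
    gapTail e (b - c) k = gapTail e b k - gapTail e c k := by
  rw [gapTail, gapTail, gapTail,
    ← (summable_mul_gap he hlim hb k).tsum_sub (summable_mul_gap he hlim hc k)]
  exact tsum_congr fun j => sub_mul _ _ _

lemma gapTail_one_sub (hb : ∀ k, |b k| ≤ B) (k : ℕ) :
    gapTail e (1 - b) k = e k - gapTail e b k := by
  have hone : gapTail e 1 k = e k := by
    simpa [gapTail] using (hasSum_gap he hlim k).tsum_eq
  rw [gapTail_sub he hlim (B := 1) (by simp) hb, hone]

lemma gapTail_eq_gapTail_of_forall_eq_zero (hb : ∀ k, |b k| ≤ B) {k n : ℕ} (hkn : k ≤ n)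
    (h : ∀ i, k ≤ i → i < n → b i = 0) : gapTail e b k = gapTail e b n := by
  induction n, hkn using Nat.le_induction with
  | base => rfl
  | succ n hkn ih =>
    rw [ih fun i hi hin => h i hi (hin.trans n.lt_succ_self), gapTail_eq_add he hlim hb,
      h n hkn n.lt_succ_self, zero_mul, zero_add]

lemma gapTail_zero_sub_gapTail_zero (hb : ∀ k, |b k| ≤ B) (hc : ∀ k, |c k| ≤ C) {k : ℕ}
    (h : ∀ i < k, b i = c i) :
    gapTail e b 0 - gapTail e c 0 = gapTail e b k - gapTail e c k := by
  rw [← gapTail_sub he hlim hb hc, ← gapTail_sub he hlim hb hc]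
  refine gapTail_eq_gapTail_of_forall_eq_zero he hlim (B := B + C) (fun j => ?_) (Nat.zero_le k)
    fun i _ hi => ?_
  · exact (abs_sub _ _).trans (add_le_add (hb j) (hc j))
  · simp [h i hi]

lemma eq_zero_of_gapTail_eq_zero (hgap : ∀ k, B * e (k + 1) < e k - e (k + 1))
    (hb : ∀ k, |b k| ≤ B) (hb_int : ∀ k, b k = 0 ∨ 1 ≤ |b k|) (h : gapTail e b 0 = 0) (k : ℕ) :
    b k = 0 := by
  induction k using Nat.strong_induction_on with
  | _ n ih =>
    by_contra hn
    have hsum : b n * (e n - e (n + 1)) + gapTail e b (n + 1) = 0 := by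
      rw [← gapTail_eq_add he hlim hb, ← gapTail_eq_gapTail_of_forall_eq_zero he hlim hb
        (Nat.zero_le n) fun i _ hi => ih i hi, h]
    have hnonneg : 0 ≤ e n - e (n + 1) := sub_nonneg.2 (he n.le_succ)
    refine lt_irrefl (e n - e (n + 1)) ?_
    calc e n - e (n + 1) ≤ |b n| * (e n - e (n + 1)) :=
          le_mul_of_one_le_left hnonneg ((hb_int n).resolve_left hn)
      _ = |gapTail e b (n + 1)| := by
          rw [← abs_neg (gapTail e b (n + 1)), ← eq_neg_of_add_eq_zero_left hsum, abs_mul,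
            abs_of_nonneg hnonneg]
      _ ≤ B * e (n + 1) := abs_gapTail_le he hlim hb _
      _ < e n - e (n + 1) := hgap n

end Gap

/-! ### Binary digits -/

lemma antitone_half_pow : Antitone fun k : ℕ => (1 / 2 : ℝ) ^ k :=
  pow_right_anti₀ (by norm_num) (by norm_num)

lemma tendsto_half_pow : Tendsto (fun k : ℕ => (1 / 2 : ℝ) ^ k) atTop (𝓝 0) :=
  tendsto_pow_atTop_nhds_zero_of_lt_one (by norm_num) (by norm_num)

/-- The binary digit of `x` with weight `2^{-(k+1)}`, in the expansion of `x` that does not end in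
ones. -/
noncomputable def binDigit (x : ℝ) (k : ℕ) : ℝ :=
  ((⌊2 ^ (k + 1) * x⌋ - 2 * ⌊2 ^ k * x⌋ : ℤ) : ℝ)

lemma floor_two_pow_succ_mul_eq_or_eq (n : ℕ) (x : ℝ) :
    ⌊2 ^ (n + 1) * x⌋ = 2 * ⌊2 ^ n * x⌋ ∨ ⌊2 ^ (n + 1) * x⌋ = 2 * ⌊2 ^ n * x⌋ + 1 := by
  rw [pow_succ', mul_assoc]
  have hlower : 2 * ⌊2 ^ n * x⌋ ≤ ⌊2 * (2 ^ n * x)⌋ := by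
    rw [Int.le_floor]
    push_cast
    linarith [Int.floor_le (2 ^ n * x)]
  have hupper : ⌊2 * (2 ^ n * x)⌋ < 2 * ⌊2 ^ n * x⌋ + 2 := by
    rw [Int.floor_lt]
    push_cast
    linarith [Int.lt_floor_add_one (2 ^ n * x)]
  omega

lemma isBit_binDigit (x : ℝ) : IsBit (binDigit x) := by
  intro k
  rw [binDigit]
  rcases floor_two_pow_succ_mul_eq_or_eq k x with h | h <;> rw [h] <;> simp

lemma measurable_binDigit (k : ℕ) : Measurable fun x => binDigit x k := by
  unfold binDigit
  fun_prop

lemma tendsto_floor_mul_half_pow (x : ℝ) :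
    Tendsto (fun n : ℕ => (⌊2 ^ n * x⌋ : ℝ) * (1 / 2) ^ n) atTop (𝓝 x) := by
  have hcancel : ∀ n : ℕ, (2 : ℝ) ^ n * x * (1 / 2) ^ n = x := fun n => by
    rw [mul_right_comm, ← mul_pow]
    norm_num
  have hpos : ∀ n : ℕ, (0 : ℝ) ≤ (1 / 2) ^ n := fun n => by positivity
  refine tendsto_of_tendsto_of_tendsto_of_le_of_le (g := fun n => x - (1 / 2) ^ n)
    (h := fun _ => x) ?_ tendsto_const_nhds (fun n => ?_) fun n => ?_
  · simpa using tendsto_const_nhds.sub tendsto_half_pow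
  · calc x - (1 / 2) ^ n = (2 ^ n * x - 1) * (1 / 2) ^ n := by rw [sub_mul, hcancel, one_mul]
      _ ≤ ⌊2 ^ n * x⌋ * (1 / 2) ^ n :=
        mul_le_mul_of_nonneg_right (Int.sub_one_lt_floor _).le (hpos n)
  · calc ⌊2 ^ n * x⌋ * (1 / 2) ^ n ≤ 2 ^ n * x * (1 / 2) ^ n :=
        mul_le_mul_of_nonneg_right (Int.floor_le _) (hpos n)
      _ = x := hcancel n

lemma sum_range_binDigit {x : ℝ} (hx : x ∈ Set.Ico (0 : ℝ) 1) (n : ℕ) :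
    ∑ k ∈ Finset.range n, binDigit x k * ((1 / 2 : ℝ) ^ k - (1 / 2) ^ (k + 1)) =
      ⌊2 ^ n * x⌋ * (1 / 2 : ℝ) ^ n := by
  induction n with
  | zero => simp [Int.floor_eq_zero_iff.2 hx]
  | succ n ih =>
    rw [Finset.sum_range_succ, ih, binDigit]
    push_cast
    ring

lemma gapTail_binDigit {x : ℝ} (hx : x ∈ Set.Ico (0 : ℝ) 1) :
    gapTail (fun k => (1 / 2 : ℝ) ^ k) (binDigit x) 0 = x := by
  have hsum := (summable_mul_gap antitone_half_pow tendsto_half_pow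
    (isBit_binDigit x).abs_le_one 0).hasSum.tendsto_sum_nat
  simp only [add_zero, sum_range_binDigit hx] at hsum
  exact tendsto_nhds_unique hsum (tendsto_floor_mul_half_pow x)

lemma floor_two_pow_mul_eq_of_binDigit_eq {x y : ℝ} (hx : x ∈ Set.Ico (0 : ℝ) 1)
    (hy : y ∈ Set.Ico (0 : ℝ) 1) {n : ℕ} (h : ∀ k < n, binDigit x k = binDigit y k) :
    ⌊2 ^ n * x⌋ = ⌊2 ^ n * y⌋ := by
  induction n with
  | zero => simp [Int.floor_eq_zero_iff.2 hx, Int.floor_eq_zero_iff.2 hy]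
  | succ n ih =>
    have hprev := ih fun k hk => h k (hk.trans n.lt_succ_self)
    have hdigit := h n n.lt_succ_self
    simp only [binDigit, Int.cast_inj] at hdigit
    omega

lemma exists_first_binDigit_lt {x y : ℝ} (hx : x ∈ Set.Ico (0 : ℝ) 1)
    (hy : y ∈ Set.Ico (0 : ℝ) 1) (hxy : x < y) :
    ∃ k, (∀ i < k, binDigit x i = binDigit y i) ∧ binDigit x k = 0 ∧ binDigit y k = 1 := by
  classical
  have hex : ∃ k, binDigit x k ≠ binDigit y k := by
    by_contra! hcon
    rw [← gapTail_binDigit hx, ← gapTail_binDigit hy, funext hcon] at hxy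
    exact lt_irrefl _ hxy
  obtain ⟨k, hne, hmin⟩ := Nat.findX hex
  have hlt : ∀ i < k, binDigit x i = binDigit y i := fun i hi => not_not.1 (hmin i hi)
  have hle : binDigit x k ≤ binDigit y k := by
    rw [binDigit, binDigit, Int.cast_le, floor_two_pow_mul_eq_of_binDigit_eq hx hy hlt]
    gcongr
  refine ⟨k, hlt, ?_⟩
  rcases isBit_binDigit x k with hxk | hxk <;> rcases isBit_binDigit y k with hyk | hyk
  · exact absurd (hxk.trans hyk.symm) hne
  · exact ⟨hxk, hyk⟩
  · rw [hxk, hyk] at hle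
    norm_num at hle
  · exact absurd (hxk.trans hyk.symm) hne

lemma two_pow_mul_volume_floor_eq (n : ℕ) (a : ℤ) :
    2 ^ n * volume {x : ℝ | ⌊2 ^ n * x⌋ = a} = 1 := by
  have hpos : (0 : ℝ) < 2 ^ n := by positivity
  have hIco : {x : ℝ | ⌊2 ^ n * x⌋ = a} = Set.Ico ((a : ℝ) / 2 ^ n) (((a : ℝ) + 1) / 2 ^ n) := by
    ext x
    rw [Set.mem_ofPred_eq, Int.floor_eq_iff, Set.mem_Ico, div_le_iff₀ hpos, lt_div_iff₀ hpos,
      mul_comm x]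
  rw [hIco, Real.volume_Ico, ← sub_div, add_sub_cancel_left, ENNReal.ofReal_div_of_pos hpos,
    ENNReal.ofReal_pow zero_le_two, ENNReal.ofReal_one, ENNReal.ofReal_ofNat]
  exact ENNReal.mul_div_cancel (by simp) (by finiteness)

/-- The supremum of the densities of a set in the dyadic intervals of length `2⁻ⁿ`. -/
noncomputable def dyadicDensity (E : Set ℝ) (n : ℕ) : ℝ≥0∞ :=
  ⨆ a : ℤ, 2 ^ n * volume (E ∩ {x | ⌊2 ^ n * x⌋ = a})

lemma le_dyadicDensity (E : Set ℝ) (n : ℕ) (a : ℤ) :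
    2 ^ n * volume (E ∩ {x | ⌊2 ^ n * x⌋ = a}) ≤ dyadicDensity E n :=
  le_iSup (fun a : ℤ => 2 ^ n * volume (E ∩ {x | ⌊2 ^ n * x⌋ = a})) a

lemma dyadicDensity_le_one (E : Set ℝ) (n : ℕ) : dyadicDensity E n ≤ 1 :=
  iSup_le fun a => (mul_le_mul_right (measure_mono Set.inter_subset_right) _).trans_eq
    (two_pow_mul_volume_floor_eq n a)

lemma monotone_dyadicDensity (E : Set ℝ) : Monotone (dyadicDensity E) := by
  refine monotone_nat_of_le_succ fun n => iSup_le fun a => ?_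
  let D : ℤ → Set ℝ := fun a => {x | ⌊2 ^ (n + 1) * x⌋ = a}
  have hsub : E ∩ {x | ⌊2 ^ n * x⌋ = a} ⊆ (E ∩ D (2 * a)) ∪ (E ∩ D (2 * a + 1)) := by
    rintro x ⟨hx, rfl : _ = a⟩
    exact (floor_two_pow_succ_mul_eq_or_eq n x).imp (⟨hx, ·⟩) (⟨hx, ·⟩)
  refine (ENNReal.mul_le_mul_iff_right two_ne_zero ENNReal.ofNat_ne_top).1 ?_
  calc 2 * (2 ^ n * volume (E ∩ {x | ⌊2 ^ n * x⌋ = a}))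
      ≤ 2 ^ (n + 1) * (volume (E ∩ D (2 * a)) + volume (E ∩ D (2 * a + 1))) := by
        rw [← mul_assoc, ← pow_succ']
        gcongr
        exact (measure_mono hsub).trans (measure_union_le _ _)
    _ ≤ 2 * dyadicDensity E (n + 1) := by
        rw [mul_add, two_mul (dyadicDensity _ _)]
        exact add_le_add (le_dyadicDensity _ _ _) (le_dyadicDensity _ _ _)

lemma volume_eq_zero_of_iSup_dyadicDensity_eq_zero {E : Set ℝ}
    (hE : ⨆ n, dyadicDensity E n = 0) : volume E = 0 := by
  have hcover : E ⊆ ⋃ a : ℤ, E ∩ {x | ⌊2 ^ 0 * x⌋ = a} := fun x hx => Set.mem_iUnion.2 ⟨_, hx, rfl⟩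
  refine measure_mono_null hcover (measure_iUnion_null fun a => ?_)
  simpa [hE] using (le_dyadicDensity E 0 a).trans (le_iSup _ 0)

lemma two_mul_dyadicDensity_le {E : Set ℝ} {n : ℕ} {d : ℝ} (hE : ∀ x ∈ E, binDigit x n = d) :
    2 * dyadicDensity E n ≤ dyadicDensity E (n + 1) := by
  rw [dyadicDensity, ENNReal.mul_iSup]
  refine iSup_le fun a => ?_
  obtain hempty | ⟨y, hyE, rfl : _ = a⟩ := (E ∩ {x | ⌊2 ^ n * x⌋ = a}).eq_empty_or_nonempty
  · simp [hempty]
  have hsub : E ∩ {x | ⌊2 ^ n * x⌋ = ⌊2 ^ n * y⌋} ⊆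
      E ∩ {x | ⌊2 ^ (n + 1) * x⌋ = ⌊2 ^ (n + 1) * y⌋} := by
    rintro x ⟨hxE, hx : _ = _⟩
    have hdigit := (hE x hxE).trans (hE y hyE).symm
    simp only [binDigit, Int.cast_inj, hx, sub_left_inj] at hdigit
    exact ⟨hxE, hdigit⟩
  rw [← mul_assoc, ← pow_succ']
  exact (mul_le_mul_right (measure_mono hsub) _).trans (le_dyadicDensity _ _ _)

-- Each prescribed digit doubles the dyadic density, which stays bounded by one.
lemma volume_forall_binDigit_eq_zero {K : Set ℕ} (hK : K.Infinite) (c : ℕ → ℝ) :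
    volume {x : ℝ | ∀ k ∈ K, binDigit x k = c k} = 0 := by
  set E := {x : ℝ | ∀ k ∈ K, binDigit x k = c k}
  have hdouble : 2 * ⨆ n, dyadicDensity E n ≤ ⨆ n, dyadicDensity E n := by
    rw [ENNReal.mul_iSup]
    refine iSup_le fun n => ?_
    obtain ⟨k, hk, hnk⟩ := hK.exists_gt n
    calc 2 * dyadicDensity E n ≤ 2 * dyadicDensity E k := by
          gcongr
          exact monotone_dyadicDensity E hnk.le
      _ ≤ dyadicDensity E (k + 1) := two_mul_dyadicDensity_le fun x hx => hx k hk
      _ ≤ ⨆ n, dyadicDensity E n := le_iSup _ _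
  have hfin : ⨆ n, dyadicDensity E n ≠ ∞ :=
    ne_top_of_le_ne_top ENNReal.one_ne_top (iSup_le (dyadicDensity_le_one E))
  refine volume_eq_zero_of_iSup_dyadicDensity_eq_zero ?_
  by_contra hne
  refine hdouble.not_gt ?_
  rw [two_mul]
  exact ENNReal.lt_add_right hfin hne

/-! ### Gauge measures -/

/-- A gauge function, continued by `∞` from a cutoff `ε` on so as to be defined for all extended
nonnegative diameters. It determines the same measure as `h` and is monotone everywhere. -/
noncomputable def cutoffGauge (h : ℝ → ℝ) (ε : ℝ) (r : ℝ≥0∞) : ℝ≥0∞ :=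
  open Classical in if r < ENNReal.ofReal ε then ENNReal.ofReal (h r.toReal) else ∞

lemma monotone_cutoffGauge {h : ℝ → ℝ} {ε : ℝ} (hmono : MonotoneOn h (Set.Ico 0 ε)) :
    Monotone (cutoffGauge h ε) := by
  intro r s hrs
  by_cases hs : s < ENNReal.ofReal ε
  · have hmem : ∀ t < ENNReal.ofReal ε, t.toReal ∈ Set.Ico 0 ε := fun t ht =>
      ⟨ENNReal.toReal_nonneg, (ENNReal.lt_ofReal_iff_toReal_lt ht.ne_top).1 ht⟩
    have hr := hrs.trans_lt hs
    rw [cutoffGauge, cutoffGauge, if_pos hr, if_pos hs]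
    exact ENNReal.ofReal_le_ofReal
      (hmono (hmem r hr) (hmem s hs) (ENNReal.toReal_mono hs.ne_top hrs))
  · simp [cutoffGauge, if_neg hs]

section GaugeMeasure

variable {Y Z : Type*} [MetricSpace Y] [MeasurableSpace Y] [BorelSpace Y]
  [MetricSpace Z] [MeasurableSpace Z] [BorelSpace Z] {h : ℝ → ℝ}

lemma gaugeMeasure_eq_mkMetric_cutoffGauge {ε : ℝ} (hε : 0 < ε) :
    gaugeMeasure Y h = Measure.mkMetric (cutoffGauge h ε) := by
  have heq : (fun r : ℝ≥0∞ => ENNReal.ofReal (h r.toReal)) =ᶠ[𝓝 0] cutoffGauge h ε := by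
    filter_upwards [Iio_mem_nhds (ENNReal.ofReal_pos.2 hε)] with r hr
    exact (if_pos hr).symm
  exact le_antisymm (Measure.mkMetric_mono heq.le) (Measure.mkMetric_mono heq.symm.le)

lemma gaugeMeasure_image (hh : IsGauge h) {f : Y → Z} (hf : Isometry f) (s : Set Y) :
    gaugeMeasure Z h (f '' s) = gaugeMeasure Y h s := by
  obtain ⟨ε, hε, -, hmono, -⟩ := hh
  rw [gaugeMeasure_eq_mkMetric_cutoffGauge hε, gaugeMeasure_eq_mkMetric_cutoffGauge hε,
    ← OuterMeasure.coe_mkMetric, ← OuterMeasure.coe_mkMetric,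
    ← OuterMeasure.isometry_comap_mkMetric _ hf (Or.inl (monotone_cutoffGauge hmono)),
    OuterMeasure.comap_apply]

lemma gaugeMeasure_singleton (h0 : h 0 = 0) (x : Y) : gaugeMeasure Y h {x} = 0 := by
  refine le_antisymm ((Measure.mkMetric_le_liminf_sum (β := ℕ) (ι := fun _ => Unit) (l := atTop) {x}
    (fun _ => 0) tendsto_const_nhds (fun _ _ => {x}) (by simp) (by simp) _).trans ?_) zero_le
  simp [h0]

end GaugeMeasure

/-! ### Cantor sets with a gauge function -/

/-- The Cantor set of all sums `∑ b_j (e_j - e_{j+1})` with `b_j ∈ {0, 1}`. -/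
def cantorSet (e : ℕ → ℝ) : Set ℝ := {s | ∃ b, IsBit b ∧ gapTail e b 0 = s}

/-- The map from `[0, 1)` to the Cantor set that turns the binary digits of `x` into the
coefficients `b_j`. -/
noncomputable def cantorMap (e : ℕ → ℝ) (x : ℝ) : ℝ := gapTail e (binDigit x) 0

/-- The uniform distribution on the Cantor set: the coefficients `b_j` are independent fair bits. -/
noncomputable def cantorMeasure (e : ℕ → ℝ) : Measure ℝ :=
  (volume.restrict (Set.Ico 0 1)).map (cantorMap e)

/-- The points of the Cantor set whose first `n` coefficients are given by `p`. -/
def cantorCylinder (e : ℕ → ℝ) {n : ℕ} (p : Fin n → Fin 2) : Set ℝ :=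
  {s | ∃ b, IsBit b ∧ (∀ i : Fin n, b i = ((p i : ℕ) : ℝ)) ∧ gapTail e b 0 = s}

/-- The gauge function `h` is adapted to the Cantor set defined by the sequence `e`: it assigns
`2⁻ᵏ` to the length `e k` of the `k`-th generation intervals (with `k ≥ 1`, as `h` need not be
defined at `1`), and it bounds the mass of shorter intervals because of `sub_le`, a weak form of
concavity. -/
structure IsCantorGauge (e : ℕ → ℝ) (h : ℝ → ℝ) : Prop where
  e_zero : e 0 = 1
  e_pos : ∀ k, 0 < e k
  four_mul_e_succ_le : ∀ k, 4 * e (k + 1) ≤ e k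
  e_rational : ∀ k, e k ∈ (algebraMap ℚ ℝ).range
  gauge : IsGauge h
  mono : MonotoneOn h (Set.Ico 0 1)
  h_zero : h 0 = 0
  h_e_succ : ∀ k, h (e (k + 1)) = (1 / 2) ^ (k + 1)
  sub_le : ∀ k v w, v ∈ Set.Icc 0 (e (k + 2)) → w ∈ Set.Icc 0 (e (k + 2)) →
    h (e (k + 1)) - h (e (k + 1) - v - w) ≤ (h v + h w) / 2

lemma cantorSet_subset_iUnion_cantorCylinder (e : ℕ → ℝ) (n : ℕ) :
    cantorSet e ⊆ ⋃ p : Fin n → Fin 2, cantorCylinder e p := by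
  classical
  rintro _ ⟨b, hb, rfl⟩
  refine Set.mem_iUnion.2 ⟨fun i => if b i = 0 then 0 else 1, b, hb, fun i => ?_, rfl⟩
  rcases hb i with h | h <;> simp [h]

namespace IsCantorGauge

variable {e : ℕ → ℝ} {h : ℝ → ℝ} (H : IsCantorGauge e h)

include H

lemma antitone : Antitone e :=
  antitone_nat_of_succ_le fun k => by linarith [H.four_mul_e_succ_le k, H.e_pos (k + 1)]

lemma tendsto : Tendsto e atTop (𝓝 0) := by
  have hle : ∀ k, e k ≤ (1 / 2) ^ k := by
    intro k
    induction k with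
    | zero => simp [H.e_zero]
    | succ k ih =>
      rw [pow_succ]
      linarith [H.four_mul_e_succ_le k, H.e_pos (k + 1)]
  exact squeeze_zero (fun k => (H.e_pos k).le) hle tendsto_half_pow

lemma e_succ_le (k : ℕ) : e (k + 1) ≤ 1 / 4 := by
  have hone : e (k + 1) ≤ e (0 + 1) := H.antitone (Nat.add_le_add_right k.zero_le 1)
  linarith [H.four_mul_e_succ_le 0, H.e_zero]

lemma e_succ_mem_Ico (k : ℕ) : e (k + 1) ∈ Set.Ico (0 : ℝ) 1 :=
  ⟨(H.e_pos _).le, by linarith [H.e_succ_le k]⟩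

lemma two_mul_e_succ_lt (k : ℕ) : 2 * e (k + 1) < e k - e (k + 1) := by
  linarith [H.four_mul_e_succ_le k, H.e_pos (k + 1)]

lemma gapTail_mem {b : ℕ → ℝ} (hb : IsBit b) (k : ℕ) : gapTail e b k ∈ Set.Icc 0 (e k) :=
  ⟨gapTail_nonneg H.antitone hb.nonneg k, hb.gapTail_le H.antitone H.tendsto k⟩

lemma cantorSet_subset : cantorSet e ⊆ Set.Icc 0 1 := by
  rintro _ ⟨b, hb, rfl⟩
  rw [← H.e_zero]
  exact H.gapTail_mem hb 0

lemma isCompact_cantorSet : IsCompact (cantorSet e) := by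
  have himage : cantorSet e =
      (fun b => gapTail e b 0) '' (Set.univ.pi fun _ : ℕ => ({0, 1} : Set ℝ)) := by
    ext s
    simp [cantorSet, IsBit]
  rw [himage]
  refine (isCompact_univ_pi fun _ => (Set.toFinite _).isCompact).image_of_continuousOn ?_
  unfold gapTail
  refine continuousOn_tsum (fun j => by fun_prop) (hasSum_gap H.antitone H.tendsto 0).summable ?_
  intro j b hb
  have hbit : IsBit b := fun k => by simpa using hb k (Set.mem_univ k)
  simpa only [one_mul] using norm_mul_gap_le H.antitone hbit.abs_le_one (j + 0)

lemma measurableSet_cantorSet : MeasurableSet (cantorSet e) :=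
  H.isCompact_cantorSet.isClosed.measurableSet

lemma one_sub_mem {s : ℝ} (hs : s ∈ cantorSet e) : 1 - s ∈ cantorSet e := by
  obtain ⟨b, hb, rfl⟩ := hs
  exact ⟨1 - b, hb.one_sub, by
    rw [gapTail_one_sub H.antitone H.tendsto hb.abs_le_one, H.e_zero]⟩

lemma measurable_cantorMap : Measurable (cantorMap e) := by
  refine measurable_of_tendsto_metrizable
    (f := fun n x => ∑ j ∈ Finset.range n, binDigit x (j + 0) * (e (j + 0) - e (j + 0 + 1)))
    (fun n => ?_) (tendsto_pi_nhds.2 fun x => ?_)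
  · exact Finset.measurable_fun_sum _ fun j _ => (measurable_binDigit _).mul_const _
  · exact (summable_mul_gap H.antitone H.tendsto (isBit_binDigit x).abs_le_one
      0).hasSum.tendsto_sum_nat

lemma h_gapTail_div_two_le {b : ℕ → ℝ} (hb : IsBit b) (k : ℕ) :
    h (gapTail e b (k + 1)) / 2 ≤ gapTail (fun j => (1 / 2 : ℝ) ^ j) b (k + 1) := by
  rcases hb.forall_eq_zero_or_exists_first (k + 1) with hzero | ⟨_ | i, hki, hi, hlt⟩
  · have htail : ∀ e' : ℕ → ℝ, gapTail e' b (k + 1) = 0 := fun e' => by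
      simp [gapTail, hzero _ (Nat.le_add_left _ _)]
    rw [htail, htail, H.h_zero, zero_div]
  · exact absurd hki (Nat.not_succ_le_zero k)
  rw [gapTail_eq_gapTail_of_forall_eq_zero H.antitone H.tendsto hb.abs_le_one hki hlt,
    gapTail_eq_gapTail_of_forall_eq_zero antitone_half_pow tendsto_half_pow hb.abs_le_one hki hlt]
  have hmem := H.gapTail_mem hb (i + 1)
  have hfirst : (1 / 2 : ℝ) ^ (i + 1) - (1 / 2) ^ (i + 2) ≤
      gapTail (fun j => (1 / 2 : ℝ) ^ j) b (i + 1) := by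
    rw [gapTail_eq_add antitone_half_pow tendsto_half_pow hb.abs_le_one, hi, one_mul]
    exact le_add_of_nonneg_right (gapTail_nonneg antitone_half_pow hb.nonneg _)
  calc h (gapTail e b (i + 1)) / 2 ≤ h (e (i + 1)) / 2 := by
        gcongr
        exact H.mono ⟨hmem.1, hmem.2.trans_lt (H.e_succ_mem_Ico i).2⟩ (H.e_succ_mem_Ico i) hmem.2
    _ = (1 / 2 : ℝ) ^ (i + 1) - (1 / 2) ^ (i + 2) := by
        rw [H.h_e_succ]
        ring
    _ ≤ _ := hfirst

section FirstDifference

variable {b c : ℕ → ℝ} (hb : IsBit b) (hc : IsBit c) {k : ℕ}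

include hb hc

lemma e_sub_two_mul_le (hbc : ∀ i < k, b i = c i) (hbk : b k = 0) (hck : c k = 1) :
    e k - 2 * e (k + 1) ≤ gapTail e c 0 - gapTail e b 0 := by
  rw [gapTail_zero_sub_gapTail_zero H.antitone H.tendsto hc.abs_le_one hb.abs_le_one
      fun i hi => (hbc i hi).symm, gapTail_eq_add H.antitone H.tendsto hc.abs_le_one,
    gapTail_eq_add H.antitone H.tendsto hb.abs_le_one, hbk, hck]
  linarith [(H.gapTail_mem hb (k + 1)).2, (H.gapTail_mem hc (k + 1)).1]

-- The first point lies `v = gapTail e b (k + 2)` to the right of the left end of an interval of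
-- generation `k + 1`, the second one `w = gapTail e (1 - c) (k + 2)` to the left of its right end.
-- The pieces cut off have masses at least `h v / 2` and `h w / 2`, so that `sub_le` applies.
lemma dyadic_sub_le_h (hbc : ∀ i < k + 1, b i = c i) (hbk : b (k + 1) = 0)
    (hck : c (k + 1) = 1) :
    gapTail (fun j => (1 / 2 : ℝ) ^ j) c 0 - gapTail (fun j => (1 / 2 : ℝ) ^ j) b 0 ≤
      h (gapTail e c 0 - gapTail e b 0) := by
  have hcb : ∀ i < k + 1, c i = b i := fun i hi => (hbc i hi).symm
  have hmass_left := H.h_gapTail_div_two_le hb (k + 1)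
  have hmass_right := H.h_gapTail_div_two_le hc.one_sub (k + 1)
  have hsub := H.sub_le k _ _ (H.gapTail_mem hb (k + 2)) (H.gapTail_mem hc.one_sub (k + 2))
  rw [gapTail_one_sub antitone_half_pow tendsto_half_pow hc.abs_le_one] at hmass_right
  rw [H.h_e_succ] at hsub
  have hdist : gapTail e c 0 - gapTail e b 0 =
      e (k + 1) - gapTail e b (k + 2) - gapTail e (1 - c) (k + 2) := by
    rw [gapTail_zero_sub_gapTail_zero H.antitone H.tendsto hc.abs_le_one hb.abs_le_one hcb,
      gapTail_eq_add H.antitone H.tendsto hc.abs_le_one,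
      gapTail_eq_add H.antitone H.tendsto hb.abs_le_one, hbk, hck,
      gapTail_one_sub H.antitone H.tendsto hc.abs_le_one]
    ring
  rw [hdist, gapTail_zero_sub_gapTail_zero antitone_half_pow tendsto_half_pow hc.abs_le_one
      hb.abs_le_one hcb, gapTail_eq_add antitone_half_pow tendsto_half_pow hc.abs_le_one,
    gapTail_eq_add antitone_half_pow tendsto_half_pow hb.abs_le_one, hbk, hck]
  linarith

end FirstDifference

lemma abs_sub_le_h {x y : ℝ} (hx : x ∈ Set.Ico (0 : ℝ) 1) (hy : y ∈ Set.Ico (0 : ℝ) 1) {r : ℝ}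
    (hr : r ≤ 1 / 4) (hxy : |cantorMap e x - cantorMap e y| ≤ r) : |x - y| ≤ h r := by
  wlog hle : x ≤ y generalizing x y
  · rw [abs_sub_comm] at hxy ⊢
    exact this hy hx hxy (not_le.1 hle).le
  have hr_mem : r ∈ Set.Ico (0 : ℝ) 1 := ⟨(abs_nonneg _).trans hxy, by linarith⟩
  rcases hle.eq_or_lt with rfl | hlt
  · rw [sub_self, abs_zero, ← H.h_zero]
    exact H.mono ⟨le_rfl, one_pos⟩ hr_mem hr_mem.1
  obtain ⟨k, hk, hxk, hyk⟩ := exists_first_binDigit_lt hx hy hlt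
  have hgap := H.e_sub_two_mul_le (isBit_binDigit x) (isBit_binDigit y) hk hxk hyk
  have hdist : cantorMap e y - cantorMap e x ≤ r := by
    rw [abs_sub_comm] at hxy
    exact (le_abs_self _).trans hxy
  rcases k with _ | k
  · rw [H.e_zero] at hgap
    linarith [hgap.trans hdist, H.e_succ_le 0]
  have hnonneg : 0 ≤ cantorMap e y - cantorMap e x :=
    le_trans (by linarith [H.two_mul_e_succ_lt (k + 1), H.e_pos (k + 2)]) hgap
  calc |x - y| = gapTail (fun j => (1 / 2 : ℝ) ^ j) (binDigit y) 0 -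
        gapTail (fun j => (1 / 2 : ℝ) ^ j) (binDigit x) 0 := by
        rw [gapTail_binDigit hx, gapTail_binDigit hy, abs_sub_comm, abs_of_pos (sub_pos.2 hlt)]
    _ ≤ h (cantorMap e y - cantorMap e x) :=
        H.dyadic_sub_le_h (isBit_binDigit x) (isBit_binDigit y) hk hxk hyk
    _ ≤ h r := H.mono ⟨hnonneg, hdist.trans_lt hr_mem.2⟩ hr_mem hdist

lemma cantorMeasure_le_gaugeMeasure : cantorMeasure e ≤ gaugeMeasure ℝ h := by
  refine Measure.le_mkMetric _ _ (ENNReal.ofReal (1 / 4)) (by simp) fun I hI => ?_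
  have hclosed : MeasurableSet (closure I) := isClosed_closure.measurableSet
  rw [← Metric.ediam_closure] at hI ⊢
  refine (measure_mono subset_closure).trans ?_
  rw [cantorMeasure, Measure.map_apply H.measurable_cantorMap hclosed,
    Measure.restrict_apply (H.measurable_cantorMap hclosed)]
  refine (Real.volume_le_diam _).trans (Metric.ediam_le ?_)
  rintro x ⟨hxI, hx⟩ y ⟨hyI, hy⟩
  have hfin : Metric.ediam (closure I) ≠ ∞ := ne_top_of_le_ne_top ENNReal.ofReal_ne_top hI
  rw [edist_dist, Real.dist_eq]
  refine ENNReal.ofReal_le_ofReal (H.abs_sub_le_h hx hy ?_ ?_)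
  · simpa using ENNReal.toReal_mono ENNReal.ofReal_ne_top hI
  · rw [← Real.dist_eq, dist_edist]
    exact ENNReal.toReal_mono hfin (Metric.edist_le_ediam_of_mem hxI hyI)

lemma ediam_cantorCylinder_le {n : ℕ} (p : Fin n → Fin 2) :
    Metric.ediam (cantorCylinder e p) ≤ ENNReal.ofReal (e n) := by
  refine Metric.ediam_le ?_
  rintro _ ⟨b, hb, hbp, rfl⟩ _ ⟨c, hc, hcp, rfl⟩
  rw [edist_dist, Real.dist_eq, gapTail_zero_sub_gapTail_zero (k := n) H.antitone H.tendsto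
    hb.abs_le_one hc.abs_le_one fun i hi => (hbp ⟨i, hi⟩).trans (hcp ⟨i, hi⟩).symm]
  refine ENNReal.ofReal_le_ofReal ?_
  simpa only [sub_zero] using
    abs_sub_le_of_le_of_le (H.gapTail_mem hb n).1 (H.gapTail_mem hb n).2
      (H.gapTail_mem hc n).1 (H.gapTail_mem hc n).2

lemma h_ediam_cantorCylinder_le {k : ℕ} (p : Fin (k + 1) → Fin 2) :
    h (Metric.ediam (cantorCylinder e p)).toReal ≤ (1 / 2) ^ (k + 1) := by
  have hle : (Metric.ediam (cantorCylinder e p)).toReal ≤ e (k + 1) :=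
    ENNReal.toReal_le_of_le_ofReal (H.e_pos _).le (H.ediam_cantorCylinder_le p)
  rw [← H.h_e_succ]
  exact H.mono ⟨ENNReal.toReal_nonneg, hle.trans_lt (H.e_succ_mem_Ico k).2⟩ (H.e_succ_mem_Ico k) hle

lemma gaugeMeasure_cantorSet_le : gaugeMeasure ℝ h (cantorSet e) ≤ 1 := by
  refine (Measure.mkMetric_le_liminf_sum (l := atTop) (cantorSet e) (fun n => ENNReal.ofReal (e n))
    (by simpa using ENNReal.tendsto_ofReal H.tendsto) (fun _ => cantorCylinder e)
    (.of_forall fun _ => H.ediam_cantorCylinder_le)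
    (.of_forall (cantorSet_subset_iUnion_cantorCylinder e)) _).trans ?_
  refine (liminf_le_liminf (v := fun _ => (1 : ℝ≥0∞)) ?_).trans (liminf_const _).le
  filter_upwards [eventually_ge_atTop 1] with n hn
  obtain ⟨k, rfl⟩ := Nat.exists_eq_add_of_le' hn
  calc ∑ p : Fin (k + 1) → Fin 2,
        ENNReal.ofReal (h (Metric.ediam (cantorCylinder e p)).toReal)
      ≤ ∑ _p : Fin (k + 1) → Fin 2, ENNReal.ofReal ((1 / 2) ^ (k + 1)) :=
        Finset.sum_le_sum fun p _ => ENNReal.ofReal_le_ofReal (H.h_ediam_cantorCylinder_le p)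
    _ = ENNReal.ofReal (2 ^ (k + 1) * (1 / 2) ^ (k + 1)) := by
        rw [Finset.sum_const, Finset.card_univ, Fintype.card_fun, Fintype.card_fin,
          Fintype.card_fin, nsmul_eq_mul, ENNReal.ofReal_mul (by positivity)]
        simp [ENNReal.ofReal_pow]
    _ = 1 := by
        rw [← mul_pow]
        norm_num

lemma isProbabilityMeasure_cantorMeasure : IsProbabilityMeasure (cantorMeasure e) := by
  refine ⟨?_⟩
  rw [cantorMeasure, Measure.map_apply H.measurable_cantorMap MeasurableSet.univ]
  simp

theorem restrict_cantorSet_gaugeMeasure :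
    (gaugeMeasure ℝ h).restrict (cantorSet e) = cantorMeasure e := by
  have hprob := H.isProbabilityMeasure_cantorMeasure
  have hsupp : (cantorMeasure e).restrict (cantorSet e) = cantorMeasure e :=
    Measure.restrict_eq_self_of_ae_mem ((ae_map_iff H.measurable_cantorMap.aemeasurable
      H.measurableSet_cantorSet).2 (ae_of_all _ fun x => ⟨_, isBit_binDigit x, rfl⟩))
  have hle : cantorMeasure e ≤ (gaugeMeasure ℝ h).restrict (cantorSet e) := by
    rw [← hsupp]
    exact Measure.restrict_mono le_rfl H.cantorMeasure_le_gaugeMeasure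
  have htotal : (gaugeMeasure ℝ h).restrict (cantorSet e) Set.univ ≤ cantorMeasure e Set.univ := by
    rw [Measure.restrict_apply_univ, measure_univ]
    exact H.gaugeMeasure_cantorSet_le
  exact (Measure.eq_of_le_of_measure_univ_eq hle ((hle _).antisymm htotal)).symm

lemma cantorMeasure_apply {T : Set ℝ} (hT : MeasurableSet T) :
    cantorMeasure e T = gaugeMeasure ℝ h (T ∩ cantorSet e) := by
  rw [← H.restrict_cantorSet_gaugeMeasure, Measure.restrict_apply hT]

theorem gaugeMeasure_cantorSet : gaugeMeasure ℝ h (cantorSet e) = 1 := by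
  have := H.isProbabilityMeasure_cantorMeasure
  rw [← Set.univ_inter (cantorSet e), ← H.cantorMeasure_apply .univ, measure_univ]

lemma cantorMeasure_singleton (x : ℝ) : cantorMeasure e {x} = 0 := by
  rw [H.cantorMeasure_apply (measurableSet_singleton x)]
  exact measure_mono_null Set.inter_subset_left (gaugeMeasure_singleton H.h_zero x)

lemma cantorMeasure_preimage_isometryEquiv {T : Set ℝ} (hT : MeasurableSet T) (f : ℝ ≃ᵢ ℝ) :
    cantorMeasure e (f ⁻¹' T) = gaugeMeasure ℝ h (T ∩ f '' cantorSet e) := by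
  rw [H.cantorMeasure_apply (hT.preimage f.continuous.measurable),
    ← gaugeMeasure_image H.gauge f.isometry, Set.image_preimage_inter]

lemma cantorMeasure_one_sub {T : Set ℝ} (hT : MeasurableSet T) :
    cantorMeasure e {s | 1 - s ∈ T} = cantorMeasure e T := by
  have himage : (fun s : ℝ => 1 - s) '' cantorSet e = cantorSet e := by
    refine Set.Subset.antisymm (Set.image_subset_iff.2 fun s => H.one_sub_mem) fun s hs => ?_
    exact ⟨1 - s, H.one_sub_mem hs, sub_sub_cancel 1 s⟩
  rw [H.cantorMeasure_apply hT, ← himage]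
  exact H.cantorMeasure_preimage_isometryEquiv hT (.subLeft 1)

lemma gaugeMeasure_unitInterval_cantorSet :
    gaugeMeasure unitInterval h {x | (x : ℝ) ∈ cantorSet e} = 1 := by
  rw [← gaugeMeasure_image H.gauge (isometry_subtype_coe (s := unitInterval)),
    ← H.gaugeMeasure_cantorSet]
  congr 1
  exact Set.image_preimage_eq_of_subset (Subtype.range_coe ▸ H.cantorSet_subset)

end IsCantorGauge

/-! ### Irrational translates of a Cantor set -/

lemma gapTail_mem_of_finite {R : Subring ℝ} {e b : ℕ → ℝ} (he : ∀ k, e k ∈ R) (hb : ∀ k, b k ∈ R)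
    (hfin : {k | b k ≠ 0}.Finite) : gapTail e b 0 ∈ R := by
  rw [gapTail, tsum_eq_sum (s := hfin.toFinset)]
  · exact sum_mem fun k _ => mul_mem (hb _) (sub_mem (he _) (he _))
  · intro k hk
    have hzero : b k = 0 := by simpa using hk
    rw [add_zero, hzero, zero_mul]

namespace IsBit

variable {b c b' c' : ℕ → ℝ}

lemma mem_subring (hb : IsBit b) (R : Subring ℝ) (k : ℕ) : b k ∈ R := by
  rcases hb k with h | h <;> rw [h]
  exacts [zero_mem R, one_mem R]

lemma abs_sub_le_one (hb : IsBit b) (hc : IsBit c) (k : ℕ) : |(b - c) k| ≤ 1 := by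
  rcases hb k with h | h <;> rcases hc k with h' | h' <;> simp [h, h']

variable (hb : IsBit b) (hc : IsBit c) (hb' : IsBit b') (hc' : IsBit c')

include hb hc hb' hc'

lemma eq_of_sub_eq_sub {k : ℕ} (h : (b - c) k = (b' - c') k) (hne : (b' - c') k ≠ 0) :
    b k = b' k := by
  revert h hne
  simp only [Pi.sub_apply]
  rcases hb k with hbk | hbk <;> rcases hc k with hck | hck <;> rcases hb' k with hbk' | hbk' <;>
    rcases hc' k with hck' | hck' <;>
    rw [hbk, hck, hbk', hck'] <;> norm_num

lemma sub_sub_sub_eq_zero_or_one_le_abs (k : ℕ) :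
    (b - c - (b' - c')) k = 0 ∨ 1 ≤ |(b - c - (b' - c')) k| := by
  simp only [Pi.sub_apply]
  rcases hb k with hbk | hbk <;> rcases hc k with hck | hck <;> rcases hb' k with hbk' | hbk' <;>
    rcases hc' k with hck' | hck' <;> rw [hbk, hck, hbk', hck'] <;> norm_num

lemma sub_eq_sub_of_gapTail_eq {e : ℕ → ℝ} (he : Antitone e) (hlim : Tendsto e atTop (𝓝 0))
    (hgap : ∀ k, 2 * e (k + 1) < e k - e (k + 1))
    (h : gapTail e (b - c) 0 = gapTail e (b' - c') 0) : b - c = b' - c' := by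
  refine funext fun k => sub_eq_zero.1 (eq_zero_of_gapTail_eq_zero he hlim hgap (fun k => ?_)
    (sub_sub_sub_eq_zero_or_one_le_abs hb hc hb' hc') ?_ k)
  · refine (abs_sub _ _).trans ?_
    linarith [hb.abs_sub_le_one hc k, hb'.abs_sub_le_one hc' k]
  · rw [gapTail_sub he hlim (hb.abs_sub_le_one hc) (hb'.abs_sub_le_one hc'), h, sub_self]

end IsBit

-- All representations `t = s - s'` with `s`, `s'` in the Cantor set have the same coefficients in
-- `{-1, 0, 1}`, and each nonzero one prescribes a coefficient of `s`.
theorem IsCantorGauge.cantorMeasure_translate_eq_zero {e : ℕ → ℝ} {h : ℝ → ℝ}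
    (H : IsCantorGauge e h) {t : ℝ} (ht : t ∉ (algebraMap ℚ ℝ).range) :
    cantorMeasure e {s | s - t ∈ cantorSet e} = 0 := by
  have hmeas : MeasurableSet {s | s - t ∈ cantorSet e} :=
    H.measurableSet_cantorSet.preimage (measurable_id.sub_const t)
  rw [cantorMeasure, Measure.map_apply H.measurable_cantorMap hmeas]
  refine Measure.restrict_le_self.absolutelyContinuous ?_
  have hrepr : ∀ x c, IsBit c → gapTail e c 0 = cantorMap e x - t →
      gapTail e (binDigit x - c) 0 = t := by
    intro x c hc hx
    rw [gapTail_sub H.antitone H.tendsto (isBit_binDigit x).abs_le_one hc.abs_le_one, hx]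
    exact sub_sub_cancel _ _
  obtain hempty | ⟨x₀, c₀, hc₀, hx₀⟩ :=
    (cantorMap e ⁻¹' {s | s - t ∈ cantorSet e}).eq_empty_or_nonempty
  · simp [hempty]
  have hinf : {k | (binDigit x₀ - c₀) k ≠ 0}.Infinite := by
    refine fun hfin => ht ?_
    rw [← hrepr x₀ c₀ hc₀ hx₀]
    exact gapTail_mem_of_finite H.e_rational (fun k =>
      sub_mem ((isBit_binDigit x₀).mem_subring _ k) (hc₀.mem_subring _ k)) hfin
  refine measure_mono_null ?_ (volume_forall_binDigit_eq_zero hinf (binDigit x₀))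
  rintro x ⟨c, hc, hx⟩ k hk
  have hsub := (isBit_binDigit x).sub_eq_sub_of_gapTail_eq hc (isBit_binDigit x₀) hc₀ H.antitone
    H.tendsto H.two_mul_e_succ_lt ((hrepr x c hc hx).trans (hrepr x₀ c₀ hc₀ hx₀).symm)
  exact (isBit_binDigit x).eq_of_sub_eq_sub hc (isBit_binDigit x₀) hc₀ (congrFun hsub k) hk

/-! ### The graphoning of a Cantor set -/

lemma volume_unitInterval_eq_hausdorffMeasure : (volume : Measure unitInterval) = μH[1] := by
  ext s -
  rw [← isometry_subtype_coe.hausdorffMeasure_image (Or.inl zero_le_one), hausdorffMeasure_real]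
  exact comap_subtype_coe_apply measurableSet_Icc volume s

lemma abs_mem_iff {S : Set ℝ} (hS : S ⊆ Set.Ici 0) (t : ℝ) : |t| ∈ S ↔ t ∈ S ∨ -t ∈ S := by
  constructor
  · rcases abs_choice t with habs | habs <;> rw [habs]
    exacts [Or.inl, Or.inr]
  · rintro (ht | ht)
    · rwa [abs_of_nonneg (hS ht)]
    · rwa [abs_of_nonpos (neg_nonneg.1 (hS ht))]

lemma measurableSet_abs_sub_mem {S : Set ℝ} (hS : MeasurableSet S) (x : ℝ) :
    MeasurableSet {y : unitInterval | |x - y| ∈ S} :=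
  hS.preimage (by fun_prop)

lemma degree_differenceGraphoning {S : Set ℝ} {h : ℝ → ℝ} (hS : MeasurableSet S) (hh : IsGauge h)
    (A : Set unitInterval) (x : unitInterval) :
    (differenceGraphoning S h).degree A x =
      gaugeMeasure ℝ h ((↑) '' A ∩ {y | |(x : ℝ) - y| ∈ S}) := by
  have hmeas := measurableSet_abs_sub_mem hS x
  have hindicator : ∀ y : unitInterval, ENNReal.ofReal ((differenceGraphoning S h).W x y) =
      {y : unitInterval | |(x : ℝ) - y| ∈ S}.indicator 1 y := by
    intro y
    by_cases hy : |(x : ℝ) - y| ∈ S <;> simp [differenceGraphoning, hy]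
  rw [GraphoningData.degree, lintegral_congr hindicator, lintegral_indicator_one hmeas,
    Measure.restrict_apply hmeas, Set.inter_comm]
  change gaugeMeasure unitInterval h _ = _
  rw [← gaugeMeasure_image hh isometry_subtype_coe]
  exact congrArg _ (Set.image_inter_preimage _ A {y | |(x : ℝ) - y| ∈ S})

lemma setLIntegral_measure_preimage {α β γ : Type*} [MeasurableSpace α] [MeasurableSpace β]
    [MeasurableSpace γ] (μ : Measure α) (ν : Measure β) [SFinite μ] [SFinite ν] {f : α × β → γ}
    (hf : Measurable f) (A : Set α) {B : Set γ} (hB : MeasurableSet B) :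
    ∫⁻ x in A, ν {y | f (x, y) ∈ B} ∂μ = ∫⁻ y, μ ({x | f (x, y) ∈ B} ∩ A) ∂ν := by
  have hpre : MeasurableSet (f ⁻¹' B) := hB.preimage hf
  calc ∫⁻ x in A, ν {y | f (x, y) ∈ B} ∂μ = (μ.restrict A).prod ν (f ⁻¹' B) :=
        (Measure.prod_apply hpre).symm
    _ = ∫⁻ y, μ ({x | f (x, y) ∈ B} ∩ A) ∂ν := by
        rw [Measure.prod_apply_symm hpre]
        exact lintegral_congr fun y => Measure.restrict_apply (measurable_prodMk_right hpre)

lemma volume_sub_mem_inter (A B : Set ℝ) (s : ℝ) :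
    volume ({x | x - s ∈ B} ∩ A) = volume ({x | x + s ∈ A} ∩ B) := by
  rw [← measure_preimage_add_right volume s, Set.preimage_inter, Set.inter_comm]
  simp [Set.preimage]

lemma countable_sub_mem_range_algebraMap (z : ℝ) :
    {y : unitInterval | z - y ∈ (algebraMap ℚ ℝ).range}.Countable :=
  Set.Countable.preimage_of_injOn (s := ((algebraMap ℚ ℝ).range : Set ℝ))
    (by rw [RingHom.coe_range]; exact Set.countable_range _)
    (fun _ _ _ _ hab => Subtype.ext (sub_right_injective hab))

namespace IsCantorGauge

variable {e : ℕ → ℝ} {h : ℝ → ℝ} (H : IsCantorGauge e h)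

include H

lemma cantorSet_subset_Ici : cantorSet e ⊆ Set.Ici 0 :=
  fun _ hs => (H.cantorSet_subset hs).1

lemma gaugeMeasure_inter_abs_sub_mem {T : Set ℝ} (hT : MeasurableSet T) (x : ℝ) :
    gaugeMeasure ℝ h (T ∩ {y | |x - y| ∈ cantorSet e}) =
      cantorMeasure e {s | x + s ∈ T} + cantorMeasure e {s | x - s ∈ T} := by
  have hunion : {y | |x - y| ∈ cantorSet e} =
      IsometryEquiv.addLeft x '' cantorSet e ∪ IsometryEquiv.subLeft x '' cantorSet e := by
    ext y
    rw [Set.mem_ofPred_eq, abs_mem_iff H.cantorSet_subset_Ici, or_comm]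
    rw [← IsometryEquiv.preimage_symm, ← IsometryEquiv.preimage_symm]
    simp [neg_add_eq_sub]
  have hinter : gaugeMeasure ℝ h ((T ∩ IsometryEquiv.addLeft x '' cantorSet e) ∩
      (T ∩ IsometryEquiv.subLeft x '' cantorSet e)) = 0 := by
    refine measure_mono_null ?_ (gaugeMeasure_singleton H.h_zero x)
    rintro y ⟨⟨-, s, hs, rfl⟩, -, s', hs', hss'⟩
    have hs_nonneg := H.cantorSet_subset_Ici hs
    have hs'_nonneg := H.cantorSet_subset_Ici hs'
    simp only [IsometryEquiv.addLeft_apply, IsometryEquiv.subLeft_apply, Set.mem_Ici,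
      Set.mem_singleton_iff] at *
    linarith
  have hmeas : MeasurableSet (T ∩ IsometryEquiv.subLeft x '' cantorSet e) :=
    hT.inter (H.isCompact_cantorSet.image (IsometryEquiv.subLeft x).continuous).measurableSet
  rw [hunion, Set.inter_union_distrib_left, ← add_zero (gaugeMeasure ℝ h _), ← hinter,
    measure_union_add_inter _ hmeas, ← H.cantorMeasure_preimage_isometryEquiv hT,
    ← H.cantorMeasure_preimage_isometryEquiv hT]
  rfl

lemma degree_eq {A : Set unitInterval} (hA : MeasurableSet A) (x : unitInterval) :
    (differenceGraphoning (cantorSet e) h).degree A x =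
      cantorMeasure e {s | (x : ℝ) + s ∈ ((↑) '' A : Set ℝ)} +
        cantorMeasure e {s | (x : ℝ) - s ∈ ((↑) '' A : Set ℝ)} := by
  rw [degree_differenceGraphoning H.measurableSet_cantorSet H.gauge,
    H.gaugeMeasure_inter_abs_sub_mem (measurableSet_Icc.subtype_image hA)]

-- Since `s` and `1 - s` have the same distribution, `x - s ∈ [0, 1]` is as likely as
-- `x - (1 - s) ∈ [0, 1]`, that is, as `s ∈ [1 - x, 2 - x]`.
lemma degree_univ (x : unitInterval) :
    (differenceGraphoning (cantorSet e) h).degree Set.univ x = 1 := by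
  obtain ⟨hx_nonneg, hx_le_one⟩ := x.2
  have hright : {s | (x : ℝ) + s ∈ unitInterval} = Set.Icc (-(x : ℝ)) (1 - x) := by
    rw [← zero_sub]
    exact Set.preimage_const_add_Icc ..
  have hleft : cantorMeasure e {s | (x : ℝ) - s ∈ unitInterval} =
      cantorMeasure e (Set.Icc (1 - (x : ℝ)) (2 - x)) := by
    rw [← H.cantorMeasure_one_sub measurableSet_Icc]
    congr 1
    ext s
    simp only [Set.mem_ofPred_eq, Set.mem_Icc]
    constructor <;> rintro ⟨hlower, hupper⟩ <;> constructor <;> linarith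
  have hdisjoint : AEDisjoint (cantorMeasure e) (Set.Icc (-(x : ℝ)) (1 - x))
      (Set.Icc (1 - (x : ℝ)) (2 - x)) :=
    measure_mono_null (fun s hs => le_antisymm hs.1.2 hs.2.1) (H.cantorMeasure_singleton (1 - x))
  have hcover : cantorSet e ⊆ Set.Icc (-(x : ℝ)) (2 - x) :=
    H.cantorSet_subset.trans (Set.Icc_subset_Icc (by linarith) (by linarith))
  rw [H.degree_eq MeasurableSet.univ, Set.image_univ, Subtype.range_coe, hright, hleft,
    ← measure_union₀ measurableSet_Icc.nullMeasurableSet hdisjoint,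
    Set.Icc_union_Icc_eq_Icc (by linarith) (by linarith), H.cantorMeasure_apply measurableSet_Icc,
    Set.inter_eq_right.2 hcover, H.gaugeMeasure_cantorSet]

lemma measurable_degree {A : Set unitInterval} (hA : MeasurableSet A) :
    Measurable ((differenceGraphoning (cantorSet e) h).degree A) := by
  have := H.isProbabilityMeasure_cantorMeasure
  have hA' : MeasurableSet ((↑) '' A : Set ℝ) := measurableSet_Icc.subtype_image hA
  rw [funext fun x => H.degree_eq hA x]
  have hadd : MeasurableSet {p : unitInterval × ℝ | (p.1 : ℝ) + p.2 ∈ ((↑) '' A : Set ℝ)} :=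
    hA'.preimage (by fun_prop)
  have hsub : MeasurableSet {p : unitInterval × ℝ | (p.1 : ℝ) - p.2 ∈ ((↑) '' A : Set ℝ)} :=
    hA'.preimage (by fun_prop)
  exact (measurable_measure_prodMk_left hadd).add (measurable_measure_prodMk_left hsub)

lemma setLIntegral_degree (A : Set unitInterval) {B : Set unitInterval} (hB : MeasurableSet B) :
    ∫⁻ x in A, (differenceGraphoning (cantorSet e) h).degree B x =
      ∫⁻ s, volume ({x : ℝ | x + s ∈ ((↑) '' B : Set ℝ)} ∩ (↑) '' A) ∂cantorMeasure e +
        ∫⁻ s, volume ({x : ℝ | x + s ∈ ((↑) '' A : Set ℝ)} ∩ (↑) '' B) ∂cantorMeasure e := by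
  have hprob := H.isProbabilityMeasure_cantorMeasure
  have hB' : MeasurableSet ((↑) '' B : Set ℝ) := measurableSet_Icc.subtype_image hB
  have hmeas : Measurable fun x : ℝ => cantorMeasure e {s | x + s ∈ ((↑) '' B : Set ℝ)} :=
    measurable_measure_prodMk_left (s := {p : ℝ × ℝ | p.1 + p.2 ∈ ((↑) '' B : Set ℝ)})
      (hB'.preimage (by fun_prop))
  calc ∫⁻ x in A, (differenceGraphoning (cantorSet e) h).degree B x
      = ∫⁻ x in (↑) '' A, (cantorMeasure e {s | x + s ∈ ((↑) '' B : Set ℝ)} +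
          cantorMeasure e {s | x - s ∈ ((↑) '' B : Set ℝ)}) := by
        simp_rw [H.degree_eq hB]
        exact setLIntegral_subtype measurableSet_Icc A fun x : ℝ =>
          cantorMeasure e {s | x + s ∈ ((↑) '' B : Set ℝ)} +
            cantorMeasure e {s | x - s ∈ ((↑) '' B : Set ℝ)}
    _ = ∫⁻ s, volume ({x : ℝ | x + s ∈ ((↑) '' B : Set ℝ)} ∩ (↑) '' A) ∂cantorMeasure e +
          ∫⁻ s, volume ({x : ℝ | x - s ∈ ((↑) '' B : Set ℝ)} ∩ (↑) '' A) ∂cantorMeasure e := by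
        rw [lintegral_add_left hmeas,
          setLIntegral_measure_preimage _ _ (f := fun p : ℝ × ℝ => p.1 + p.2) (by fun_prop) _ hB',
          setLIntegral_measure_preimage _ _ (f := fun p : ℝ × ℝ => p.1 - p.2) (by fun_prop) _ hB']
    _ = _ := by simp only [volume_sub_mem_inter]

theorem isGraphoning : (differenceGraphoning (cantorSet e) h).IsGraphoning where
  prob := inferInstanceAs (IsProbabilityMeasure (volume : Measure unitInterval))
  W_measurable := (measurable_const.indicator H.measurableSet_cantorSet).comp
    (by fun_prop : Measurable fun p : unitInterval × unitInterval => |(p.1 : ℝ) - p.2|)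
  W_mem x y := by
    by_cases hxy : |(x : ℝ) - y| ∈ cantorSet e <;> simp [differenceGraphoning, hxy]
  W_symm x y := by simp only [differenceGraphoning, abs_sub_comm]
  degree_bound x := (H.degree_univ x).le
  degree_measurable A hA := H.measurable_degree hA
  measure_preserving A B hA hB := by
    change ∫⁻ x in A, _ = ∫⁻ x in B, _
    rw [H.setLIntegral_degree A hB, H.setLIntegral_degree B hA, add_comm]

lemma cantorMeasure_abs_sub_eq_zero {t : ℝ} (ht : t ∉ (algebraMap ℚ ℝ).range) :
    cantorMeasure e {s | |s - t| ∈ cantorSet e} = 0 := by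
  have ht_sub_one : t - 1 ∉ (algebraMap ℚ ℝ).range := fun hmem =>
    ht (by simpa using add_mem hmem (one_mem _))
  refine measure_mono_null (fun s hs => ?_) (measure_union_null
    (H.cantorMeasure_translate_eq_zero ht) (H.cantorMeasure_translate_eq_zero ht_sub_one))
  rcases (abs_mem_iff H.cantorSet_subset_Ici _).1 hs with hmem | hmem
  · exact Or.inl hmem
  · refine Or.inr ?_
    rw [Set.mem_ofPred_eq, show s - (t - 1) = 1 - -(s - t) by ring]
    exact H.one_sub_mem hmem

lemma degree_neighborhood_eq_zero {x z : unitInterval}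
    (hxz : (z : ℝ) - x ∉ (algebraMap ℚ ℝ).range) :
    (differenceGraphoning (cantorSet e) h).degree {y | |(z : ℝ) - y| ∈ cantorSet e} x = 0 := by
  have hzx : (x : ℝ) - z ∉ (algebraMap ℚ ℝ).range := fun hmem =>
    hxz (by rw [← neg_sub]; exact neg_mem hmem)
  rw [H.degree_eq (measurableSet_abs_sub_mem H.measurableSet_cantorSet z), add_eq_zero]
  constructor
  · refine measure_mono_null ?_ (H.cantorMeasure_abs_sub_eq_zero hxz)
    rintro s ⟨y, hy, hys⟩
    rwa [Set.mem_ofPred_eq, hys, show (z : ℝ) - (x + s) = -(s - (z - x)) by ring, abs_neg] at hy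
  · refine measure_mono_null ?_ (H.cantorMeasure_abs_sub_eq_zero hzx)
    rintro s ⟨y, hy, hys⟩
    rwa [Set.mem_ofPred_eq, hys, show (z : ℝ) - (x - s) = s - (x - z) by ring] at hy

theorem codegreeBound :
    (differenceGraphoning (cantorSet e) h).toPseudo.CodegreeBound
      (fun x y => (x : ℝ) - y ∈ (algebraMap ℚ ℝ).range) 0 where
  symm x y hxy := by
    rw [← neg_sub]
    exact neg_mem hxy
  deg_rel_le x z := by
    refine (withDensity_absolutelyContinuous _ _ ?_).le
    rw [← Set.biUnion_of_singleton {y : unitInterval | (z : ℝ) - y ∈ (algebraMap ℚ ℝ).range},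
      measure_biUnion_null_iff (countable_sub_mem_range_algebraMap z)]
    exact fun y _ => gaugeMeasure_singleton H.h_zero y
  codegree_le x z hzx := by
    have hsupport : {y | (differenceGraphoning (cantorSet e) h).toPseudo.W z y ≠ 0} =
        {y : unitInterval | |(z : ℝ) - y| ∈ cantorSet e} := by
      ext y
      simp [GraphoningData.toPseudo, differenceGraphoning]
    rw [hsupport, GraphoningData.toPseudo_deg _ _
      (measurableSet_abs_sub_mem H.measurableSet_cantorSet z), H.degree_neighborhood_eq_zero hzx]

lemma isHausdorff : (differenceGraphoning (cantorSet e) h).IsHausdorff h where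
  graphoning := H.isGraphoning
  gauge := H.gauge
  lam_eq := volume_unitInterval_eq_hausdorffMeasure
  mu_eq := rfl

theorem isEuclideanLimit {V : ℕ → Type*} {G : ∀ n, SimpleGraph (V n)} {d : ℕ → ℕ} {c : ℕ}
    (hG : ∀ n, IsSparseRegular (G n) (d n) c) (hd : Tendsto d atTop atTop)
    (hgrowth : Asymptotics.IsEquivalent atTop (fun n => h (1 / (Nat.card (V n) : ℝ)))
      (fun n => 1 / (d n : ℝ))) :
    IsEuclideanLimit G (fun n => (d n : ℝ)) (differenceGraphoning (cantorSet e) h) h where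
  limit := isLimit_of_isSparseRegular hG hd H.isGraphoning.isPseudoGraphoning
    (fun x => by rw [GraphoningData.toPseudo_deg _ _ MeasurableSet.univ, H.degree_univ])
    H.codegreeBound
  euclidean := H.isHausdorff
  growth := hgrowth

end IsCantorGauge

/-! ### Binary expansions with constant blocks -/

/-- The sums `∑ a_j 2^{-j}` whose digits are constant on the blocks `M k < j ≤ M (k + 1)`. Both
`SCube` and `SProj` are of this form. -/
def blockSet (M : ℕ → ℕ) : Set ℝ :=
  {s | ∃ a : ℕ → Fin 2, (∀ k, ∀ i ∈ Set.Ioc (M k) (M (k + 1)), ∀ j ∈ Set.Ioc (M k) (M (k + 1)),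
      a i = a j) ∧ HasSum (fun j : ℕ => ((a (j + 1) : ℕ) : ℝ) * (1 / 2) ^ (j + 1)) s}

lemma sum_Ico_half_pow {m n : ℕ} (hmn : m ≤ n) :
    ∑ j ∈ Finset.Ico m n, (1 / 2 : ℝ) ^ (j + 1) = (1 / 2) ^ m - (1 / 2) ^ n := by
  induction n, hmn using Nat.le_induction with
  | base => simp
  | succ n hmn ih =>
    rw [Finset.sum_Ico_succ_top hmn, ih]
    ring

lemma isBit_natCast_val (a : ℕ → Fin 2) : IsBit fun k => ((a k : ℕ) : ℝ) := by
  have hval : ∀ c : Fin 2, ((c : ℕ) : ℝ) = 0 ∨ ((c : ℕ) : ℝ) = 1 := by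
    intro c
    fin_cases c <;> simp
  exact fun k => hval (a k)

lemma IsBit.exists_natCast_val_eq {b : ℕ → ℝ} (hb : IsBit b) :
    ∃ c : ℕ → Fin 2, ∀ k, ((c k : ℕ) : ℝ) = b k := by
  classical
  exact ⟨fun k => if b k = 0 then 0 else 1, fun k => by rcases hb k with h | h <;> simp [h]⟩

lemma summable_natCast_val_mul_half_pow (a : ℕ → Fin 2) :
    Summable fun j : ℕ => ((a (j + 1) : ℕ) : ℝ) * (1 / 2) ^ (j + 1) := by
  refine Summable.of_nonneg_of_le (fun j => by positivity) (fun j => ?_)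
    ((summable_nat_add_iff 1).2 summable_geometric_two)
  refine mul_le_of_le_one_left (by positivity) ?_
  exact_mod_cast Nat.lt_succ_iff.1 (a (j + 1)).2

section Blocks

variable {M : ℕ → ℕ}

lemma sum_range_eq_sum_blocks (hM0 : M 0 = 0) (hM : Monotone M) {a b : ℕ → ℝ}
    (hab : ∀ k, ∀ i ∈ Set.Ioc (M k) (M (k + 1)), a i = b k) (n : ℕ) :
    ∑ j ∈ Finset.range (M n), a (j + 1) * (1 / 2) ^ (j + 1) =
      ∑ k ∈ Finset.range n, b k * ((1 / 2) ^ M k - (1 / 2) ^ M (k + 1)) := by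
  induction n with
  | zero => simp [hM0]
  | succ n ih =>
    have hle : M n ≤ M (n + 1) := hM n.le_succ
    rw [Finset.sum_range_succ, ← ih, ← sum_Ico_half_pow hle, ← Finset.sum_range_add_sum_Ico _ hle,
      Finset.mul_sum]
    congr 1
    refine Finset.sum_congr rfl fun j hj => ?_
    rw [Finset.mem_Ico] at hj
    rw [hab n (j + 1) ⟨by omega, by omega⟩]

lemma hasSum_blocks (hM0 : M 0 = 0) (hM : StrictMono M) {a : ℕ → Fin 2} {b : ℕ → ℝ}
    (hab : ∀ k, ∀ i ∈ Set.Ioc (M k) (M (k + 1)), ((a i : ℕ) : ℝ) = b k) (hb : IsBit b) :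
    HasSum (fun j : ℕ => ((a (j + 1) : ℕ) : ℝ) * (1 / 2) ^ (j + 1))
      (gapTail (fun k => (1 / 2 : ℝ) ^ M k) b 0) := by
  have hanti : Antitone fun k => (1 / 2 : ℝ) ^ M k := antitone_half_pow.comp_monotone hM.monotone
  have hlim : Tendsto (fun k => (1 / 2 : ℝ) ^ M k) atTop (𝓝 0) :=
    tendsto_half_pow.comp hM.tendsto_atTop
  have hdigits := (summable_natCast_val_mul_half_pow a).hasSum
  have hblocks := (summable_mul_gap hanti hlim hb.abs_le_one 0).hasSum.tendsto_sum_nat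
  have hpartial := (hdigits.tendsto_sum_nat.comp hM.tendsto_atTop).congr
    (sum_range_eq_sum_blocks hM0 hM.monotone hab)
  rw [gapTail, ← tendsto_nhds_unique hpartial hblocks]
  exact hdigits

lemma exists_blockIndex (hM : StrictMono M) :
    ∃ index : ℕ → ℕ, ∀ k, ∀ i ∈ Set.Ioc (M k) (M (k + 1)), index i = k := by
  have hexists : ∀ i, ∃ k, i ≤ M (k + 1) := fun i => ⟨i, (Nat.le_succ i).trans (hM.id_le _)⟩
  refine ⟨fun i => Nat.find (hexists i), fun k i hi => (Nat.find_eq_iff _).2 ⟨hi.2, ?_⟩⟩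
  exact fun m hm hle => (hi.1.trans_le (hle.trans (hM.monotone hm))).false

theorem blockSet_eq_cantorSet (hM0 : M 0 = 0) (hM : StrictMono M) :
    blockSet M = cantorSet fun k => (1 / 2 : ℝ) ^ M k := by
  ext s
  constructor
  · rintro ⟨a, ha, hs⟩
    have hbit := isBit_natCast_val fun k => a (M (k + 1))
    refine ⟨_, hbit, (hasSum_blocks hM0 hM (fun k i hi => ?_) hbit).unique hs⟩
    rw [ha k i hi (M (k + 1)) ⟨hM k.lt_succ_self, le_rfl⟩]
  · rintro ⟨b, hb, rfl⟩
    obtain ⟨index, hindex⟩ := exists_blockIndex hM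
    obtain ⟨c, hc⟩ := hb.exists_natCast_val_eq
    refine ⟨fun i => c (index i), fun k i hi j hj => ?_,
      hasSum_blocks (a := fun i => c (index i)) hM0 hM (fun k i hi => ?_) hb⟩
    · simp only [hindex k i hi, hindex k j hj]
    · simp only [hindex k i hi, hc]

end Blocks

/-- The block boundaries `0, 2, 4, 8, 16, …` of `SCube`. -/
def cubeCut : ℕ → ℕ
  | 0 => 0
  | k + 1 => 2 ^ (k + 1)

/-- The block boundaries `0, 3, 5, 7, 9, …` of `SProj`. -/
def projCut : ℕ → ℕ
  | 0 => 0
  | k + 1 => 2 * k + 3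

lemma cubeCut_add_two_le (k : ℕ) : cubeCut k + 2 ≤ cubeCut (k + 1) := by
  rcases k with _ | k
  · simp [cubeCut]
  · have := Nat.one_le_two_pow (n := k)
    simp only [cubeCut, pow_succ]
    omega

lemma projCut_add_two_le (k : ℕ) : projCut k + 2 ≤ projCut (k + 1) := by
  rcases k with _ | k <;> simp only [projCut] <;> omega

lemma SCube_eq_blockSet : SCube = blockSet cubeCut := by
  ext s
  refine exists_congr fun a => ?_
  rw [← and_assoc]
  refine and_congr_left fun _ => ⟨?_, fun ha => ⟨?_, fun k hk => ?_⟩⟩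
  · rintro ⟨hfirst, hrest⟩ (_ | k)
    · have hlast : ∀ i ∈ Set.Ioc (cubeCut 0) (cubeCut 1), a i = a 2 := by
        rintro i ⟨hi_pos, hi_le⟩
        simp only [cubeCut, zero_add, pow_one] at hi_pos hi_le
        interval_cases i
        exacts [hfirst, rfl]
      exact fun i hi j hj => (hlast i hi).trans (hlast j hj).symm
    · exact hrest (k + 1) (Nat.le_add_left 1 k)
  · exact ha 0 1 (by simp [cubeCut]) 2 (by simp [cubeCut])
  · obtain ⟨k, rfl⟩ := Nat.exists_eq_add_of_le' hk
    exact ha (k + 1)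

lemma SProj_eq_blockSet : SProj = blockSet projCut := by
  ext s
  refine exists_congr fun a => ?_
  rw [← and_assoc, ← and_assoc]
  refine and_congr_left fun _ => ⟨?_, fun ha => ⟨⟨?_, ?_⟩, fun k hk => ?_⟩⟩
  · rintro ⟨⟨hone_two, htwo_three⟩, hpairs⟩ (_ | k)
    · have hlast : ∀ i ∈ Set.Ioc (projCut 0) (projCut 1), a i = a 3 := by
        rintro i ⟨hi_pos, hi_le⟩
        simp only [projCut, mul_zero, zero_add] at hi_pos hi_le
        interval_cases i
        exacts [hone_two.trans htwo_three, htwo_three, rfl]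
      exact fun i hi j hj => (hlast i hi).trans (hlast j hj).symm
    · have hfirst : ∀ i ∈ Set.Ioc (projCut (k + 1)) (projCut (k + 2)), a i = a (2 * (k + 2)) := by
        rintro i ⟨hi_gt, hi_le⟩
        simp only [projCut] at hi_gt hi_le
        obtain rfl | rfl : i = 2 * (k + 2) ∨ i = 2 * (k + 2) + 1 := by omega
        exacts [rfl, (hpairs (k + 2) (Nat.le_add_left 2 k)).symm]
      exact fun i hi j hj => (hfirst i hi).trans (hfirst j hj).symm
  · exact ha 0 1 (by simp [projCut]) 2 (by simp [projCut])
  · exact ha 0 2 (by simp [projCut]) 3 (by simp [projCut])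
  · obtain ⟨k, rfl⟩ := Nat.exists_eq_add_of_le' hk
    exact ha (k + 1) _ (by simp only [projCut, Set.mem_Ioc]; omega) _
      (by simp only [projCut, Set.mem_Ioc]; omega)

lemma SCube_eq_cantorSet : SCube = cantorSet fun k => (1 / 2 : ℝ) ^ cubeCut k := by
  rw [SCube_eq_blockSet, blockSet_eq_cantorSet rfl (strictMono_nat_of_lt_succ fun k => ?_)]
  exact (Nat.lt_add_of_pos_right two_pos).trans_le (cubeCut_add_two_le k)

lemma SProj_eq_cantorSet : SProj = cantorSet fun k => (1 / 2 : ℝ) ^ projCut k := by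
  rw [SProj_eq_blockSet, blockSet_eq_cantorSet rfl (strictMono_nat_of_lt_succ fun k => ?_)]
  exact (Nat.lt_add_of_pos_right two_pos).trans_le (projCut_add_two_le k)

/-! ### The two gauge functions -/

lemma four_mul_half_pow_le {m n : ℕ} (hmn : m + 2 ≤ n) :
    4 * (1 / 2 : ℝ) ^ n ≤ (1 / 2) ^ m := by
  have hpow : (1 / 2 : ℝ) ^ n ≤ (1 / 2) ^ (m + 2) := antitone_half_pow hmn
  rw [pow_add] at hpow
  linarith

lemma half_pow_mem_range_algebraMap (n : ℕ) : (1 / 2 : ℝ) ^ n ∈ (algebraMap ℚ ℝ).range :=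
  ⟨(1 / 2) ^ n, by simp⟩

lemma hCube_zero : hCube 0 = 0 := by simp [hCube]

lemma hCube_half_pow (n : ℕ) : hCube ((1 / 2) ^ n) = 1 / n := by
  rw [hCube, one_div_pow, one_div_one_div, Real.logb_pow, Real.logb_self_eq_one one_lt_two, mul_one]

lemma logb_one_div_pos {x : ℝ} (hx : 0 < x) (hx1 : x < 1) : 0 < Real.logb 2 (1 / x) :=
  Real.logb_pos one_lt_two (one_lt_one_div hx hx1)

lemma monotoneOn_hCube : MonotoneOn hCube (Set.Ico 0 1) := by
  intro x hx y hy hxy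
  rcases hx.1.eq_or_lt with rfl | hx0
  · rw [hCube_zero]
    rcases hxy.eq_or_lt with rfl | hy0
    · rw [hCube_zero]
    · exact one_div_nonneg.2 (logb_one_div_pos hy0 hy.2).le
  · have hy0 := hx0.trans_le hxy
    refine one_div_le_one_div_of_le (logb_one_div_pos hy0 hy.2) ?_
    exact Real.logb_le_logb_of_le one_lt_two (by positivity) (one_div_le_one_div_of_le hx0 hxy)

lemma continuousWithinAt_hCube {x : ℝ} (hx : x ∈ Set.Ico 0 1) :
    ContinuousWithinAt hCube (Set.Ici x) x := by
  rcases hx.1.eq_or_lt with rfl | hx0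
  · rw [← continuousWithinAt_Ioi_iff_Ici, ContinuousWithinAt, hCube_zero]
    have hlog : Tendsto (fun x : ℝ => Real.logb 2 (1 / x)) (𝓝[>] 0) atTop := by
      simp_rw [one_div]
      exact (Real.tendsto_logb_atTop one_lt_two).comp tendsto_inv_nhdsGT_zero
    exact (tendsto_inv_atTop_zero.comp hlog).congr fun x => (one_div _).symm
  · have hinv : ContinuousAt (fun x : ℝ => 1 / x) x := by fun_prop (disch := exact hx0.ne')
    have hlog : ContinuousAt (fun x : ℝ => Real.logb 2 (1 / x)) x :=
      (Real.continuousAt_logb (by positivity)).comp hinv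
    exact (continuousAt_const.div hlog (logb_one_div_pos hx0 hx.2).ne').continuousWithinAt

lemma isGauge_hCube : IsGauge hCube := by
  refine ⟨1, one_pos, fun x hx => ?_, monotoneOn_hCube, fun x hx => continuousWithinAt_hCube hx⟩
  rw [← hCube_zero]
  exact monotoneOn_hCube ⟨le_rfl, one_pos⟩ hx hx.1

lemma neg_two_mul_le_logb_one_sub {t : ℝ} (ht0 : 0 ≤ t) (ht : t ≤ 1 / 2) :
    -(2 * t) ≤ Real.logb 2 (1 - t) := by
  have hconcave := strictConcaveOn_log_Ioi.concaveOn.2 (show (1 : ℝ) ∈ Set.Ioi 0 by simp)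
    (show (1 / 2 : ℝ) ∈ Set.Ioi 0 by simp) (show 0 ≤ 1 - 2 * t by linarith)
    (show 0 ≤ 2 * t by linarith) (by ring)
  simp only [smul_eq_mul, Real.log_one, mul_zero, zero_add, mul_one, one_div, Real.log_inv]
    at hconcave
  rw [show 1 - 2 * t + 2 * t * 2⁻¹ = 1 - t by ring] at hconcave
  rw [Real.logb, le_div_iff₀ (Real.log_pos one_lt_two)]
  linarith

lemma mul_logb_one_div_le {v c : ℝ} (hv : 0 < v) (hvc : v ≤ c) (hc : c ≤ 1 / 3) :
    v * Real.logb 2 (1 / v) ≤ c * Real.logb 2 (1 / c) := by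
  have hc_pos : 0 < c := hv.trans_le hvc
  have hexp : Real.exp 1 ≤ 3 := (Real.exp_one_lt_d9.trans (by norm_num)).le
  have hthree : (3 : ℝ) ≤ 1 / c := by
    rw [le_div_iff₀ hc_pos]
    linarith
  have hcv : 1 / c ≤ 1 / v := one_div_le_one_div_of_le hv hvc
  have hlog := Real.log_div_self_antitoneOn
    (show 1 / c ∈ {x | Real.exp 1 ≤ x} from hexp.trans hthree)
    (show 1 / v ∈ {x | Real.exp 1 ≤ x} from hexp.trans (hthree.trans hcv)) hcv
  simp only [div_div_eq_mul_div, div_one] at hlog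
  simp only [Real.logb, mul_div_assoc']
  refine div_le_div_of_nonneg_right ?_ (Real.log_pos one_lt_two).le
  linarith

section CubeConcavity

variable {a : ℝ} (ha0 : 0 < a) (ha : a ≤ 1 / 4)

include ha0 ha

lemma two_mul_div_le_hCube {v : ℝ} (hv : v ∈ Set.Icc 0 (a ^ 2)) :
    2 * v / (a * Real.logb 2 (1 / a) ^ 2) ≤ hCube v / 2 := by
  obtain ⟨hv0, hva⟩ := hv
  rcases hv0.eq_or_lt with rfl | hv0
  · simp [hCube_zero]
  have hsq : a ^ 2 ≤ 1 / 16 := by nlinarith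
  have hA : 2 ≤ Real.logb 2 (1 / a) := by
    rw [Real.le_logb_iff_rpow_le one_lt_two (by positivity), le_div_iff₀ ha0]
    norm_num
    linarith
  have hV := logb_one_div_pos hv0 (by linarith)
  have hmono := mul_logb_one_div_le hv0 hva (by linarith)
  rw [← one_div_pow, Real.logb_pow, Nat.cast_ofNat] at hmono
  rw [hCube, div_div, div_le_div_iff₀ (by positivity) (by positivity)]
  nlinarith [mul_nonneg ha0.le (zero_le_two.trans hA)]

lemma hCube_sub_hCube_sub_le {u : ℝ} (hu : u ∈ Set.Icc 0 (a / 2)) :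
    hCube a - hCube (a - u) ≤ 2 * u / (a * Real.logb 2 (1 / a) ^ 2) := by
  obtain ⟨t, rfl⟩ : ∃ t, u = a * t := ⟨u / a, by field_simp⟩
  have ht0 : 0 ≤ t := nonneg_of_mul_nonneg_right hu.1 ha0
  have ht : t ≤ 1 / 2 := by nlinarith [hu.2]
  have hA := logb_one_div_pos ha0 (by linarith)
  have hlog : Real.logb 2 (1 / (a - a * t)) ≤ Real.logb 2 (1 / a) + 2 * t := by
    rw [show a - a * t = a * (1 - t) by ring, one_div, one_div, Real.logb_inv, Real.logb_inv,
      Real.logb_mul ha0.ne' (by linarith)]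
    linarith [neg_two_mul_le_logb_one_sub ht0 ht]
  have hlog_pos : 0 < Real.logb 2 (1 / (a - a * t)) :=
    logb_one_div_pos (by linarith [hu.2]) (by linarith [hu.1])
  calc hCube a - hCube (a - a * t)
      ≤ 1 / Real.logb 2 (1 / a) - 1 / (Real.logb 2 (1 / a) + 2 * t) :=
        sub_le_sub_left (one_div_le_one_div_of_le hlog_pos hlog) _
    _ = 2 * t / (Real.logb 2 (1 / a) * (Real.logb 2 (1 / a) + 2 * t)) := by
        field_simp
        ring
    _ ≤ 2 * t / Real.logb 2 (1 / a) ^ 2 := by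
        gcongr
        nlinarith
    _ = 2 * (a * t) / (a * Real.logb 2 (1 / a) ^ 2) := by field_simp

lemma hCube_sub_le {v w : ℝ} (hv : v ∈ Set.Icc 0 (a ^ 2)) (hw : w ∈ Set.Icc 0 (a ^ 2)) :
    hCube a - hCube (a - v - w) ≤ (hCube v + hCube w) / 2 := by
  have hsq : a ^ 2 ≤ a / 4 := by nlinarith
  have hu : v + w ∈ Set.Icc 0 (a / 2) := ⟨add_nonneg hv.1 hw.1, by linarith [hv.2, hw.2]⟩
  calc hCube a - hCube (a - v - w)
      ≤ 2 * (v + w) / (a * Real.logb 2 (1 / a) ^ 2) := by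
        rw [sub_sub]
        exact hCube_sub_hCube_sub_le ha0 ha hu
    _ = 2 * v / (a * Real.logb 2 (1 / a) ^ 2) + 2 * w / (a * Real.logb 2 (1 / a) ^ 2) := by
        rw [mul_add, add_div]
    _ ≤ hCube v / 2 + hCube w / 2 :=
        add_le_add (two_mul_div_le_hCube ha0 ha hv) (two_mul_div_le_hCube ha0 ha hw)
    _ = (hCube v + hCube w) / 2 := (add_div _ _ _).symm

end CubeConcavity

theorem isCantorGauge_hCube : IsCantorGauge (fun k => (1 / 2 : ℝ) ^ cubeCut k) hCube where
  e_zero := pow_zero _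
  e_pos k := by positivity
  four_mul_e_succ_le k := four_mul_half_pow_le (cubeCut_add_two_le k)
  e_rational k := half_pow_mem_range_algebraMap _
  gauge := isGauge_hCube
  mono := monotoneOn_hCube
  h_zero := hCube_zero
  h_e_succ k := by
    rw [hCube_half_pow, cubeCut, one_div_pow, Nat.cast_pow, Nat.cast_ofNat]
  sub_le k v w hv hw := by
    have hsquare : (1 / 2 : ℝ) ^ cubeCut (k + 2) = ((1 / 2) ^ cubeCut (k + 1)) ^ 2 := by
      rw [← pow_mul]
      rfl
    have hle_one : (1 / 2 : ℝ) ^ cubeCut k ≤ 1 := pow_le_one₀ (by norm_num) (by norm_num)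
    simp only [hsquare] at hv hw
    refine hCube_sub_le (by positivity) ?_ hv hw
    linarith [four_mul_half_pow_le (cubeCut_add_two_le k)]

lemma monotone_hProj : Monotone hProj := fun _ _ h => Real.sqrt_le_sqrt (by linarith)

lemma continuous_hProj : Continuous hProj := by
  unfold hProj
  fun_prop

lemma hProj_le_half {a x : ℝ} (hx : x ≤ a / 4) : hProj x ≤ hProj a / 2 := by
  refine (monotone_hProj hx).trans_eq ?_
  rw [hProj, hProj, show 2 * (a / 4) = 2 * a / 2 ^ 2 by ring, Real.sqrt_div' _ (by positivity),
    Real.sqrt_sq zero_le_two]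

lemma hProj_sub_le {a v w : ℝ} (ha : 0 ≤ a) (hv : v ∈ Set.Icc 0 (a / 4))
    (hw : w ∈ Set.Icc 0 (a / 4)) : hProj a - hProj (a - v - w) ≤ (hProj v + hProj w) / 2 := by
  have hsq : ∀ x, 0 ≤ x → hProj x ^ 2 = 2 * x := fun x hx => Real.sq_sqrt (by linarith)
  have hnonneg : ∀ x, 0 ≤ hProj x := fun x => Real.sqrt_nonneg _
  have hv_le := hProj_le_half hv.2
  have hw_le := hProj_le_half hw.2
  rw [sub_le_comm]
  refine (le_abs_self _).trans (Real.abs_le_sqrt ?_)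
  nlinarith [hsq a ha, hsq v hv.1, hsq w hw.1, mul_le_mul_of_nonneg_left hv_le (hnonneg v),
    mul_le_mul_of_nonneg_left hw_le (hnonneg w), mul_le_mul_of_nonneg_left hv_le (hnonneg w)]

theorem isCantorGauge_hProj : IsCantorGauge (fun k => (1 / 2 : ℝ) ^ projCut k) hProj where
  e_zero := pow_zero _
  e_pos k := by positivity
  four_mul_e_succ_le k := four_mul_half_pow_le (projCut_add_two_le k)
  e_rational k := half_pow_mem_range_algebraMap _
  gauge := ⟨1, one_pos, fun x _ => Real.sqrt_nonneg _, monotone_hProj.monotoneOn _,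
    fun x _ => continuous_hProj.continuousWithinAt⟩
  mono := monotone_hProj.monotoneOn _
  h_zero := by simp [hProj]
  h_e_succ k := by
    have hsquare : 2 * (1 / 2 : ℝ) ^ projCut (k + 1) = ((1 / 2) ^ (k + 1)) ^ 2 := by
      rw [projCut]
      ring
    rw [hProj, hsquare, Real.sqrt_sq (by positivity)]
  sub_le k v w hv hw := by
    have hquarter : (1 / 2 : ℝ) ^ projCut (k + 2) = (1 / 2) ^ projCut (k + 1) / 4 := by
      rw [projCut, projCut]
      ring
    simp only [hquarter] at hv hw
    exact hProj_sub_le (by positivity) hv hw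

lemma isEquivalent_hCube_card_hypercube :
    Asymptotics.IsEquivalent atTop
      (fun n : ℕ => hCube (1 / (Nat.card (Fin (n + 1) → Fin 2) : ℝ)))
      (fun n => 1 / ((n + 1 : ℕ) : ℝ)) := by
  refine Asymptotics.IsEquivalent.refl.congr_left (.of_forall fun n => ?_)
  simp only [Nat.card_eq_fintype_card, Fintype.card_fun, Fintype.card_fin, Nat.cast_pow,
    Nat.cast_ofNat]
  rw [← one_div_pow, hCube_half_pow]

lemma isEquivalent_hProj_card_point_sum_line {P L : ℕ → Type*} [∀ n, Finite (P n)]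
    [∀ n, Finite (L n)] [∀ n, Membership (P n) (L n)]
    [∀ n, Configuration.ProjectivePlane (P n) (L n)] {q : ℕ → ℕ}
    (horder : ∀ n, Configuration.ProjectivePlane.order (P n) (L n) = q n)
    (hq : Tendsto q atTop atTop) :
    Asymptotics.IsEquivalent atTop (fun n => hProj (1 / (Nat.card (P n ⊕ L n) : ℝ)))
      (fun n => 1 / ((q n + 1 : ℕ) : ℝ)) := by
  refine Asymptotics.isEquivalent_of_tendsto_one ?_
  have hinv : Tendsto (fun n => 1 / ((q n : ℝ) + 1)) atTop (𝓝 0) :=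
    tendsto_one_div_add_atTop_nhds_zero_nat.comp hq
  have hratio : Tendsto (fun n => (q n : ℝ) / ((q n : ℝ) ^ 2 + q n + 1)) atTop (𝓝 0) := by
    refine squeeze_zero (fun n => by positivity) (fun n => ?_) hinv
    rw [div_le_div_iff₀ (by positivity) (by positivity)]
    nlinarith
  have hsqrt := (hratio.const_add 1).sqrt
  rw [add_zero, Real.sqrt_one] at hsqrt
  refine hsqrt.congr fun n => ?_
  have hratio_eq : 1 + (q n : ℝ) / ((q n : ℝ) ^ 2 + q n + 1) =
      2 * (1 / (Nat.card (P n ⊕ L n) : ℝ)) * ((q n : ℝ) + 1) ^ 2 := by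
    rw [card_point_sum_line, horder]
    push_cast
    field_simp
    ring
  rw [hratio_eq, Real.sqrt_mul (by positivity), Real.sqrt_sq (by positivity)]
  simp [hProj]

end GraphLimits

theorem mainTheorem6 :
    (GraphLimits.gaugeMeasure unitInterval GraphLimits.hCube
        ((fun x : unitInterval => (x : ℝ)) ⁻¹' GraphLimits.SCube) = 1 ∧
      GraphLimits.IsEuclideanLimit (V := fun n => Fin (n + 1) → Fin 2)
        (fun n => GraphLimits.hypercube (n + 1)) (fun n => ((n + 1 : ℕ) : ℝ))
        (GraphLimits.differenceGraphoning GraphLimits.SCube GraphLimits.hCube)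
        GraphLimits.hCube) ∧
    (GraphLimits.gaugeMeasure unitInterval GraphLimits.hProj
        ((fun x : unitInterval => (x : ℝ)) ⁻¹' GraphLimits.SProj) = 1 ∧
      ∀ (P L : ℕ → Type*) [∀ n, Finite (P n)] [∀ n, Finite (L n)]
        [∀ n, Membership (P n) (L n)] [∀ n, Configuration.ProjectivePlane (P n) (L n)]
        (q : ℕ → ℕ), (∀ n, Configuration.ProjectivePlane.order (P n) (L n) = q n) →
        Filter.Tendsto q Filter.atTop Filter.atTop →
        GraphLimits.IsEuclideanLimit (V := fun n => P n ⊕ L n)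
          (fun n => GraphLimits.incidenceGraph (P n) (L n)) (fun n => (q n : ℝ) + 1)
          (GraphLimits.differenceGraphoning GraphLimits.SProj GraphLimits.hProj)
          GraphLimits.hProj) := by
  rw [GraphLimits.SCube_eq_cantorSet, GraphLimits.SProj_eq_cantorSet]
  refine ⟨⟨GraphLimits.isCantorGauge_hCube.gaugeMeasure_unitInterval_cantorSet, ?_⟩,
    GraphLimits.isCantorGauge_hProj.gaugeMeasure_unitInterval_cantorSet, ?_⟩
  · exact GraphLimits.isCantorGauge_hCube.isEuclideanLimit
      (fun n => GraphLimits.isSparseRegular_hypercube n.succ_pos) (tendsto_add_atTop_nat 1)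
      GraphLimits.isEquivalent_hCube_card_hypercube
  · intro P L _ _ _ _ q horder hq
    have hlimit := GraphLimits.isCantorGauge_hProj.isEuclideanLimit (d := fun n => q n + 1)
      (fun n => horder n ▸ GraphLimits.isSparseRegular_incidenceGraph (P n) (L n))
      ((tendsto_add_atTop_nat 1).comp hq)
      (GraphLimits.isEquivalent_hProj_card_point_sum_line horder hq)
    simpa only [Nat.cast_add, Nat.cast_one] using hlimit
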